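/- **Setting.** Fix integers $o\ge 3$ and $l\ge 1$ and a real $\rho_{\max}>0$. A latent tree with $o$ observed nodes is a tree whose node set consists of $o$ labelled observed nodes $x_1,\dots,x_o$ and finitely many hidden nodes; two latent trees are regarded as equal if there is a graph isomorphism between them that fixes every observed node. The class $\mathcal T(o,\rho_{\max},l)$ consists of all nondegenerate Gaussian distributions $\mathcal N(\mathbf 0,\mathbf\Sigma)$ of a family $(\mathbf x_i)_{i\in\mathcal V}$ of $\mathbb R^{l}$-valued vectors such that: (1) the underlying graph $\mathbb T=(\mathcal V,\mathcal E)$, in which distinct $i,j$ are adjacent if and only if the block $(\mathbf\Sigma^{-1})_{ij}\in\mathbb R^{l\times l}$ is nonzero, is a latent tree with $o$ observed nodes in which each hidden node has at least three neighbours; (2) there is $\rho_{\min}>0$ such that $\rho_{\min}\le \mathrm d(x_i,x_j)\le\rho_{\max}$ for all distinct nodes $i,j\in\mathcal V$, where $$\mathrm d(x_i,x_j)=-\log\frac{\prod_{k=1}^{l}\sigma_k(\mathbf\Sigma_{ij})}{\sqrt{\det(\mathbf\Sigma_{ii})\det(\mathbf\Sigma_{jj})}},\qquad \mathbf\Sigma_{ij}=\mathbb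 E[\mathbf x_i\mathbf x_j^{\mathrm T}],$$ and $\sigma_k$ denotes the $k$-th largest singular value. A decoder is a measurable map $\phi$ from $\mathbb R^{n\times o\times l}$ to the set of latent trees with $o$ observed nodes. It is applied to $n$ i.i.d. samples $\mathbf X_1^n$ of the observed vectors $(\mathbf x_1,\dots,\mathbf x_o)$. Write $L=\lfloor\log_3 o\rfloor$. **Theorem.** (a) (Non-asymptotic.) Let $\delta\in(0,1)$ and let $n\ge 0$ be an integer with $$n<\max\left\{\frac{2(1-\delta)\big(L\log 3^{1/3}-1\big)-\frac{2}{o}}{-l\log\big(1-e^{-\rho_{\max}/(L\,l)}\big)},\ \frac{(1-\delta)/5-\frac{2}{o}}{-l\log\big(1-e^{-2\rho_{\max}/(3l)}\big)}\right\}.$$ Then for every decoder $\phi$ there is a model $\theta\in\mathcal T(o,\rho_{\max},l)$ with underlying tree $\mathbb T$ such that $\mathbb P_\theta\big(\phi(\mathbf X_1^n)\ne\mathbb T\big)\ge\delta$. (b) (Asymptotic, as $\rho_{\max}\to\infty$ and $o\to\infty$.) There is an absolute constant $c>0$ such that for every $l\ge1$ and $\delta\in(0,1)$ there are $o_0$ and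 $\rho_0$ such that for all $o\ge \max\{3,o_0\}$ and all $\rho_{\max}\ge\rho_0$ with $\rho_{\max}>0$ the following holds. If, for some $n$, there is a decoder $\phi$ with $\mathbb P_\theta\big(\phi(\mathbf X_1^n)\ne\mathbb T\big)<\delta$ for every $\theta\in\mathcal T(o,\rho_{\max},l)$, where $\mathbb T$ is the underlying tree of $\theta$, then $$n\ \ge\ \max\Big\{\tfrac{c}{l}\,(1-\delta)\,e^{\rho_{\max}/(L\,l)}\log o,\ \ \tfrac{c}{l}\,(1-\delta)\,e^{2\rho_{\max}/(3l)}\Big\}.$$ -/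

import Mathlib

open MeasureTheory ProbabilityTheory

/-- A latent tree with `o` labelled observed nodes: a tree whose node set consists of the observed
nodes `Sum.inl i`, `i : Fin o`, and of finitely many hidden nodes `Sum.inr j`. -/
structure LatentTree (o : ℕ) where
  numHidden : ℕ
  graph : SimpleGraph (Fin o ⊕ Fin numHidden)
  isTree : graph.IsTree

namespace LatentTree

/-- The nodes of a latent tree, observed and hidden. -/
abbrev Node {o : ℕ} (T : LatentTree o) : Type := Fin o ⊕ Fin T.numHidden

/-- Two latent trees are the same tree if they agree up to the names of the hidden nodes: there is
a graph isomorphism that fixes each observed node. -/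
def Same {o : ℕ} (T T' : LatentTree o) : Prop :=
  ∃ f : T.graph ≃g T'.graph, ∀ i : Fin o, f (Sum.inl i) = Sum.inl i

/-- Each hidden node has at least three neighbours. -/
def HiddenDegreeGeThree {o : ℕ} (T : LatentTree o) : Prop :=
  ∀ j : Fin T.numHidden, 3 ≤ (T.graph.neighborSet (Sum.inr j)).ncard

/-- The (countable) set of latent trees carries the discrete σ-algebra. -/
instance instMeasurableSpace (o : ℕ) : MeasurableSpace (LatentTree o) := ⊤

end LatentTree

/-- The `(i, j)` block of a matrix whose rows and columns are indexed by pairs (node, coordinate);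
for a covariance matrix this is the covariance of the vectors at the nodes `i` and `j`. -/
def nodeBlock {V : Type*} {l : ℕ} (S : Matrix (V × Fin l) (V × Fin l) ℝ) (i j : V) :
    Matrix (Fin l) (Fin l) ℝ :=
  Matrix.of fun s t => S (i, s) (j, t)

/-- The product of the `l` singular values of an `l × l` real matrix, with multiplicity. -/
noncomputable def singularValueProd {l : ℕ} (M : Matrix (Fin l) (Fin l) ℝ) : ℝ :=
  ∏ k ∈ Finset.range l, (Matrix.toEuclideanLin M).singularValues k

/-- The information distance
`-log (∏ₖ σₖ(Sᵢⱼ) / √(det Sᵢᵢ * det Sⱼⱼ))` between two nodes. -/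
noncomputable def informationDistance {V : Type*} {l : ℕ}
    (S : Matrix (V × Fin l) (V × Fin l) ℝ) (i j : V) : ℝ :=
  -Real.log (singularValueProd (nodeBlock S i j) /
    Real.sqrt ((nodeBlock S i i).det * (nodeBlock S j j).det))

/-- If the block `Sᵢⱼ` is singular, where the distance is infinite on paper, the value here is `0`;
so a positive lower bound on the distance forces `Sᵢⱼ` to be nonsingular. -/
lemma informationDistance_eq_zero_of_singularValueProd_eq_zero {V : Type*} {l : ℕ}
    (S : Matrix (V × Fin l) (V × Fin l) ℝ) (i j : V)
    (h : singularValueProd (nodeBlock S i j) = 0) : informationDistance S i j = 0 := by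
  simp [informationDistance, h]

/-- The class of Gaussian latent tree models with `o` observed nodes, a random vector of dimension
`l` at each node, and all information distances in `[ρmin, ρmax]` for some `ρmin > 0`.
A member is a (nondegenerate, centred) Gaussian distribution on all nodes, given by its covariance
matrix, together with its underlying graph, which is a tree in which each hidden node has at least
three neighbours. -/
structure LatentTreeModel (o l : ℕ) (ρmax : ℝ) where
  tree : LatentTree o
  cov : Matrix (tree.Node × Fin l) (tree.Node × Fin l) ℝ
  hidden_degree : tree.HiddenDegreeGeThree
  posDef : cov.PosDef
  /-- The edges are the pairs of nodes with a nonzero block in the precision matrix. -/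
  adj_iff : ∀ i j : tree.Node, i ≠ j → (tree.graph.Adj i j ↔ nodeBlock cov⁻¹ i j ≠ 0)
  distance_bounds : ∃ ρmin : ℝ, 0 < ρmin ∧ ρmin ≤ ρmax ∧ ∀ i j : tree.Node, i ≠ j →
    ρmin ≤ informationDistance cov i j ∧ informationDistance cov i j ≤ ρmax

namespace LatentTreeModel

/-- The law of the observed variables: the marginal of `N(0, cov)` on the observed nodes. -/
noncomputable def obsLaw {o l : ℕ} {ρmax : ℝ} (θ : LatentTreeModel o l ρmax) :
    Measure (Fin o × Fin l → ℝ) :=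
  (multivariateGaussian 0 θ.cov).map fun x q => x (Sum.inl q.1, q.2)

instance isProbabilityMeasure_obsLaw {o l : ℕ} {ρmax : ℝ} (θ : LatentTreeModel o l ρmax) :
    IsProbabilityMeasure θ.obsLaw :=
  Measure.isProbabilityMeasure_map (by fun_prop)

/-- The probability that the decoder `φ`, applied to `n` i.i.d. samples of the observed variables,
does not return the tree of the model. -/
noncomputable def errorProb {o l : ℕ} {ρmax : ℝ} (θ : LatentTreeModel o l ρmax) {n : ℕ}
    (φ : (Fin n → Fin o × Fin l → ℝ) → LatentTree o) : ℝ :=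
  (Measure.pi fun _ : Fin n => θ.obsLaw).real {X | ¬ (φ X).Same θ.tree}

end LatentTreeModel

/-!
The lower bounds on the number of samples come from Fano's inequality, applied to a large family of
latent trees on which all models are close to white noise.

Each tree of the family has one hidden node, taken as root. A fixed set of observed nodes, among
them three at least, are children of the root, and every other observed node chooses its parent
freely in a fixed subset `C` of the root and those children (`HiddenRoot.attachments`). Different choices give different latent trees
(`HiddenRoot.eq_of_same`), so the family has `C.card` to the power of the number of free nodes as
its size. The variable at a node is `r` times the variable at its parent plus independent noise that
keeps the variance equal to the identity. The covariance of two nodes is then a power of `r` whose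
exponent is at most the diameter of the tree (`HiddenRoot.exists_cov_eq_pow`), and the precision
matrix has the edges of the tree as its off-diagonal support
(`RootedTree.inv_cov_apply_ne_zero_iff`). So `r` may be as small as the bound `ρmax` on the information distances permits for that diameter.

The reference law in Fano's inequality is the standard Gaussian on all nodes, hidden and observed. A
decoder sees less than all nodes, which only helps. Since all variances are one, the relative
entropy of a model with respect to the reference law is half of `-log (det cov)`, by
`integral_log_whiteningDensity`, and the determinant is `(1 - r ^ 2) ^ (o * l)`, as each of the `o`
edges contributes `l` innovations of variance `1 - r ^ 2` (`RootedTree.det_cov`). If `n` such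
entropies are less than `1 - δ` times the logarithm of the size of the family, up to `log 2`, then
some tree of the family is recognised with probability at most `1 - δ`
(`HiddenRoot.exists_le_errorProb`).

Two choices of `C` give the two terms of the bounds. If `C` consists of about `√o` children of the
root, the diameter is four and the family has about `o ^ (o / 3)` members or more. If `C` consists
of the root and one of its children, the diameter is three and the family has `2 ^ (o - 3)` members.
-/

open scoped Matrix MatrixOrder

/-! ### Testing many hypotheses against one reference measure -/

lemma integrable_of_eq_withDensity {α : Type*} [MeasurableSpace α] {P Q : Measure α}
    [IsFiniteMeasure Q] {w : α → ℝ} (hw : Measurable w) (hpos : ∀ x, 0 < w x)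
    (hQ : Q = P.withDensity fun x => ENNReal.ofReal (w x)) : Integrable w P := by
  refine ⟨hw.aestronglyMeasurable, ?_⟩
  rw [hasFiniteIntegral_iff_ofReal (ae_of_all _ fun x => (hpos x).le)]
  have : ∫⁻ x, ENNReal.ofReal (w x) ∂P = Q Set.univ := by
    rw [hQ, withDensity_apply _ MeasurableSet.univ, Measure.restrict_univ]
  rw [this]
  exact measure_lt_top _ _

/-- A change of measure from `P` to `Q = w • P` moves the probability of an event of small
`Q`-measure only as far as the relative entropy `-∫ log w ∂P` allows: this is the Donsker–Varadhan
inequality for the function `log M` times the indicator of `B`. -/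
lemma measureReal_mul_log_le {α : Type*} [MeasurableSpace α] {P Q : Measure α}
    [IsProbabilityMeasure P] [IsProbabilityMeasure Q] {w : α → ℝ} (hw : Measurable w)
    (hpos : ∀ x, 0 < w x) (hQ : Q = P.withDensity fun x => ENNReal.ofReal (w x))
    (hint : Integrable (fun x => Real.log (w x)) P) {B : Set α} (hB : MeasurableSet B)
    {M : ℝ} (hM : 1 ≤ M) :
    P.real B * Real.log M ≤ -∫ x, Real.log (w x) ∂P + Real.log (1 + (M - 1) * Q.real B) := by
  have hwint := integrable_of_eq_withDensity hw hpos hQ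
  have hQreal : ∀ A, MeasurableSet A → ∫ x in A, w x ∂P = Q.real A := by
    intro A hA
    rw [integral_eq_lintegral_of_nonneg_ae (ae_of_all _ fun x => (hpos x).le)
      hw.aestronglyMeasurable, measureReal_def, hQ, withDensity_apply _ hA]
  have hQ1 : ∫ x, w x ∂P = 1 := by
    have := hQreal Set.univ MeasurableSet.univ
    simpa using this
  set Z : ℝ := 1 + (M - 1) * Q.real B with hZ
  have hZpos : 0 < Z := by
    have : 0 ≤ (M - 1) * Q.real B := mul_nonneg (by linarith) measureReal_nonneg
    linarith
  have hMpos : 0 < M := by linarith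
  -- the inequality `log t ≤ t - 1` at `t = exp g * w / Z`, where `g` is the indicator times `log M`
  have key : ∀ x, B.indicator (fun _ => Real.log M) x + Real.log (w x) - Real.log Z ≤
      (w x + B.indicator (fun x => (M - 1) * w x) x) / Z - 1 := by
    intro x
    by_cases hx : x ∈ B
    · have h := Real.log_le_sub_one_of_pos (div_pos (mul_pos hMpos (hpos x)) hZpos)
      rw [Real.log_div (mul_pos hMpos (hpos x)).ne' hZpos.ne',
        Real.log_mul hMpos.ne' (hpos x).ne'] at h
      simp only [hx, Set.indicator_of_mem]
      calc _ ≤ _ := h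
        _ = _ := by ring
    · have h := Real.log_le_sub_one_of_pos (div_pos (hpos x) hZpos)
      rw [Real.log_div (hpos x).ne' hZpos.ne'] at h
      simpa [hx] using h
  have hi1 : Integrable (B.indicator fun _ => Real.log M) P := (integrable_const _).indicator hB
  have hi2 : Integrable (B.indicator fun x => (M - 1) * w x) P := (hwint.const_mul _).indicator hB
  have h := integral_mono ((hi1.add hint).sub (integrable_const _))
    (((hwint.add hi2).div_const Z).sub (integrable_const 1)) key
  rw [integral_sub' (hi1.add hint) (integrable_const _), integral_add' hi1 hint,
    integral_sub' ((hwint.add hi2).div_const Z) (integrable_const 1), integral_div,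
    integral_add' hwint hi2, integral_indicator hB, integral_indicator hB, integral_const_mul,
    hQreal B hB, hQ1, ← hZ, div_self hZpos.ne'] at h
  simp only [integral_const, probReal_univ, smul_eq_mul, one_mul, measureReal_restrict_apply_univ,
    sub_self] at h
  linarith

/-- A product of finite measures with densities has the product density. -/
lemma pi_withDensity_ofReal {ι : Type*} [Fintype ι] {X : ι → Type*} [∀ i, MeasurableSpace (X i)]
    (μ : ∀ i, Measure (X i)) [∀ i, SigmaFinite (μ i)] {f : ∀ i, X i → ℝ}
    (hf0 : ∀ i x, 0 ≤ f i x) (hint : ∀ i, Integrable (f i) (μ i)) :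
    Measure.pi (fun i => (μ i).withDensity fun x => ENNReal.ofReal (f i x)) =
      (Measure.pi μ).withDensity fun x => ENNReal.ofReal (∏ i, f i (x i)) := by
  have : ∀ i, IsFiniteMeasure ((μ i).withDensity fun x => ENNReal.ofReal (f i x)) := fun i =>
    isFiniteMeasure_withDensity_ofReal (hint i).2
  refine Measure.pi_eq fun s hs => ?_
  have hind : ∀ i, Integrable ((s i).indicator (f i)) (μ i) := fun i => (hint i).indicator (hs i)
  have hind0 : ∀ i x, 0 ≤ (s i).indicator (f i) x := fun i x =>
    Set.indicator_nonneg (fun y _ => hf0 i y) x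
  have hset : MeasurableSet (Set.univ.pi s) := MeasurableSet.univ_pi hs
  have hprod : ∀ x : ∀ i, X i, (Set.univ.pi s).indicator
      (fun x => ENNReal.ofReal (∏ i, f i (x i))) x =
      ENNReal.ofReal (∏ i, (s i).indicator (f i) (x i)) := by
    intro x
    by_cases hx : x ∈ Set.univ.pi s
    · rw [Set.indicator_of_mem hx]
      congr 1
      exact Finset.prod_congr rfl fun i _ => (Set.indicator_of_mem (hx i trivial) _).symm
    · rw [Set.indicator_of_notMem hx]
      obtain ⟨i, hi⟩ : ∃ i, x i ∉ s i := by simpa [Set.mem_pi] using hx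
      rw [Finset.prod_eq_zero (Finset.mem_univ i) (Set.indicator_of_notMem hi _),
        ENNReal.ofReal_zero]
  rw [withDensity_apply _ hset, ← lintegral_indicator hset, lintegral_congr hprod,
    ← ofReal_integral_eq_lintegral_ofReal (Integrable.fintype_prod_dep hind)
      (ae_of_all _ fun x => Finset.prod_nonneg fun i _ => hind0 i _),
    integral_fintype_prod_eq_prod,
    ENNReal.ofReal_prod_of_nonneg fun i _ => integral_nonneg (hind0 i)]
  refine Finset.prod_congr rfl fun i _ => ?_
  rw [withDensity_apply _ (hs i), integral_indicator (hs i),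
    ofReal_integral_eq_lintegral_ofReal (hint i).integrableOn (ae_of_all _ (hf0 i))]

/-- The relative entropy is additive over independent samples, so `n` samples multiply it by `n`. -/
lemma measureReal_pi_mul_log_le {α : Type*} [MeasurableSpace α] {P Q : Measure α}
    [IsProbabilityMeasure P] [IsProbabilityMeasure Q] {w : α → ℝ} (hw : Measurable w)
    (hpos : ∀ x, 0 < w x) (hQ : Q = P.withDensity fun x => ENNReal.ofReal (w x))
    (hint : Integrable (fun x => Real.log (w x)) P) (n : ℕ) {B : Set (Fin n → α)}
    (hB : MeasurableSet B) {M : ℝ} (hM : 1 ≤ M) :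
    (Measure.pi fun _ : Fin n => P).real B * Real.log M ≤
      n * -∫ x, Real.log (w x) ∂P +
        Real.log (1 + (M - 1) * (Measure.pi fun _ : Fin n => Q).real B) := by
  have hwint := integrable_of_eq_withDensity hw hpos hQ
  have hlog : ∀ x : Fin n → α, Real.log (∏ k, w (x k)) = ∑ k, Real.log (w (x k)) := fun x =>
    Real.log_prod fun k _ => (hpos _).ne'
  have hk : ∀ k : Fin n, Integrable (fun x : Fin n → α => Real.log (w (x k)))
      (Measure.pi fun _ : Fin n => P) := fun k =>
    integrable_comp_eval (μ := fun _ : Fin n => P) (i := k) hint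
  have h := measureReal_mul_log_le (P := Measure.pi fun _ : Fin n => P)
    (Q := Measure.pi fun _ : Fin n => Q) (w := fun x => ∏ k, w (x k)) (by fun_prop)
    (fun x => Finset.prod_pos fun k _ => hpos _)
    (by
      rw [hQ]
      exact pi_withDensity_ofReal (fun _ => P) (fun _ x => (hpos x).le)
        fun _ => hwint)
    (by
      simp_rw [hlog]
      exact integrable_finsetSum _ fun k _ => hk k) hB hM
  have hsum : ∫ x, Real.log (∏ k, w (x k)) ∂(Measure.pi fun _ : Fin n => P) =
      n * ∫ x, Real.log (w x) ∂P := by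
    simp_rw [hlog]
    rw [integral_finsetSum _ fun k _ => hk k]
    have : ∀ k : Fin n, ∫ x : Fin n → α, Real.log (w (x k)) ∂(Measure.pi fun _ : Fin n => P) =
        ∫ x, Real.log (w x) ∂P := fun k =>
      integral_comp_eval (μ := fun _ : Fin n => P) (i := k) hint.aestronglyMeasurable
    simp [this]
  rw [hsum] at h
  linarith

/-! ### The relative entropy of a Gaussian vector with respect to white noise -/

section WhiteNoise

variable {ι : Type*} [Fintype ι]

/-- The density of the standard Gaussian measure with respect to Lebesgue measure. -/
lemma stdGaussian_eq_withDensity :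
    stdGaussian (EuclideanSpace ℝ ι) = (volume : Measure (EuclideanSpace ℝ ι)).withDensity
      fun x => ENNReal.ofReal ((√(2 * Real.pi))⁻¹ ^ Fintype.card ι * Real.exp (-‖x‖ ^ 2 / 2)) := by
  have hpi : (Measure.pi fun _ : ι => gaussianReal 0 1) = (volume : Measure (ι → ℝ)).withDensity
      fun x => ENNReal.ofReal (∏ i, gaussianPDFReal 0 1 (x i)) := by
    rw [volume_pi, ← pi_withDensity_ofReal (fun _ : ι => (volume : Measure ℝ))
      (fun _ x => gaussianPDFReal_nonneg 0 1 x)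
      fun _ => integrable_gaussianPDFReal 0 1]
    simp only [gaussianReal_of_var_ne_zero 0 one_ne_zero]
    rfl
  have hprod : ∀ x : ι → ℝ, ∏ i, gaussianPDFReal 0 1 (x i) =
      (√(2 * Real.pi))⁻¹ ^ Fintype.card ι * Real.exp (-‖WithLp.toLp 2 x‖ ^ 2 / 2) := by
    intro x
    simp only [gaussianPDFReal, Finset.prod_mul_distrib, Finset.prod_const, Finset.card_univ,
      ← Real.exp_sum, EuclideanSpace.real_norm_sq_eq, NNReal.coe_one, mul_one, sub_zero]
    rw [← Finset.sum_div, Finset.sum_neg_distrib]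
  rw [← map_pi_eq_stdGaussian, hpi]
  have hvol := PiLp.volume_preserving_toLp ι
  ext s hs
  rw [Measure.map_apply (WithLp.measurable_toLp 2 _) hs, withDensity_apply _ hs,
    withDensity_apply _ (WithLp.measurable_toLp 2 _ hs), ← hvol.setLIntegral_comp_preimage hs
      (by fun_prop)]
  simp only [hprod]

variable [DecidableEq ι]

lemma integrable_norm_sq_multivariateGaussian (S : Matrix ι ι ℝ) :
    Integrable (fun x => ‖x‖ ^ 2) (multivariateGaussian 0 S) :=
  (memLp_two_iff_integrable_sq_norm (by fun_prop)).1 IsGaussian.memLp_two_id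

lemma integral_norm_sq_multivariateGaussian {S : Matrix ι ι ℝ} (hS : S.PosSemidef) :
    ∫ x, ‖x‖ ^ 2 ∂multivariateGaussian 0 S = S.trace := by
  have hmem : ∀ i, MemLp (fun x : EuclideanSpace ℝ ι => x i) 2 (multivariateGaussian 0 S) :=
    fun i => (IsGaussian.memLp_two_id (μ := multivariateGaussian 0 S)).eval_piLp i
  have hmean : ∀ i, ∫ x : EuclideanSpace ℝ ι, x i ∂multivariateGaussian 0 S = 0 := fun i => by
    have h := (EuclideanSpace.proj (𝕜 := ℝ) i).integral_comp_id_comm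
      (IsGaussian.integrable_id (μ := multivariateGaussian 0 S))
    simpa using h
  simp_rw [EuclideanSpace.real_norm_sq_eq]
  rw [integral_finsetSum _ fun i _ => (hmem i).integrable_sq, Matrix.trace]
  refine Finset.sum_congr rfl fun i _ => ?_
  rw [Matrix.diag_apply, ← variance_eval_multivariateGaussian (μ := 0) hS i,
    variance_of_integral_eq_zero (by fun_prop) (hmean i)]

/-- The density of white noise with respect to the centred Gaussian law with covariance matrix `S`.
The symmetric square root of `S` is used because it defines `multivariateGaussian 0 S`. -/
noncomputable def whiteningDensity (S : Matrix ι ι ℝ) (x : EuclideanSpace ℝ ι) : ℝ :=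
  (CFC.sqrt S).det * Real.exp (‖Matrix.toEuclideanCLM (𝕜 := ℝ) (CFC.sqrt S)⁻¹ x‖ ^ 2 / 2 -
    ‖x‖ ^ 2 / 2)

lemma measurable_whiteningDensity (S : Matrix ι ι ℝ) : Measurable (whiteningDensity S) := by
  unfold whiteningDensity
  fun_prop

lemma det_sqrt_pos {S : Matrix ι ι ℝ} (hS : S.PosDef) : 0 < (CFC.sqrt S).det := by
  have h1 : (CFC.sqrt S).det * (CFC.sqrt S).det = S.det := by
    rw [← Matrix.det_mul, CFC.sqrt_mul_sqrt_self _ hS.posSemidef.nonneg]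
  have h2 : 0 ≤ (CFC.sqrt S).det :=
    (Matrix.nonneg_iff_posSemidef.1 (CFC.sqrt_nonneg S)).det_nonneg
  have h3 := hS.det_pos
  exact lt_of_le_of_ne h2 fun h => by simp [← h] at h1; linarith

lemma log_det_sqrt {S : Matrix ι ι ℝ} (hS : S.PosDef) :
    Real.log (CFC.sqrt S).det = Real.log S.det / 2 := by
  have h1 : (CFC.sqrt S).det * (CFC.sqrt S).det = S.det := by
    rw [← Matrix.det_mul, CFC.sqrt_mul_sqrt_self _ hS.posSemidef.nonneg]
  have h := (det_sqrt_pos hS).ne'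
  rw [← h1, Real.log_mul h h]
  ring

lemma whiteningDensity_pos {S : Matrix ι ι ℝ} (hS : S.PosDef) (x : EuclideanSpace ℝ ι) :
    0 < whiteningDensity S x :=
  mul_pos (det_sqrt_pos hS) (Real.exp_pos _)

lemma multivariateGaussian_zero_eq_map (S : Matrix ι ι ℝ) :
    multivariateGaussian 0 S = (stdGaussian (EuclideanSpace ℝ ι)).map
      (Matrix.toEuclideanCLM (𝕜 := ℝ) (CFC.sqrt S)) := by
  simp [multivariateGaussian]

lemma toEuclideanCLM_inv_sqrt_apply {S : Matrix ι ι ℝ} (hS : S.PosDef) (z : EuclideanSpace ℝ ι) :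
    Matrix.toEuclideanCLM (𝕜 := ℝ) (CFC.sqrt S)⁻¹
      (Matrix.toEuclideanCLM (𝕜 := ℝ) (CFC.sqrt S) z) = z := by
  rw [← mul_apply_eq_comp, ← map_mul,
    Matrix.nonsing_inv_mul _ (det_sqrt_pos hS).ne'.isUnit, map_one, one_apply_eq_self]

lemma stdGaussian_eq_withDensity_whiteningDensity {S : Matrix ι ι ℝ} (hS : S.PosDef) :
    stdGaussian (EuclideanSpace ℝ ι) =
      (multivariateGaussian 0 S).withDensity fun x => ENNReal.ofReal (whiteningDensity S x) := by
  set L := Matrix.toEuclideanCLM (𝕜 := ℝ) (CFC.sqrt S) with hL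
  set φ : EuclideanSpace ℝ ι → ℝ := fun x =>
    (√(2 * Real.pi))⁻¹ ^ Fintype.card ι * Real.exp (-‖x‖ ^ 2 / 2) with hφ
  have hdet : LinearMap.det (L : EuclideanSpace ℝ ι →ₗ[ℝ] EuclideanSpace ℝ ι) =
      (CFC.sqrt S).det := by
    rw [hL, Matrix.coe_toEuclideanCLM_eq_toEuclideanLin, Matrix.toEuclideanLin,
      Matrix.toLpLin_eq_toLin,
      LinearMap.det_toLin]
  have hpos := det_sqrt_pos hS
  -- Lebesgue measure is scaled by the determinant of the linear map
  have hmap : (volume : Measure (EuclideanSpace ℝ ι)).map L =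
      ENNReal.ofReal (CFC.sqrt S).det⁻¹ • volume := by
    have := Measure.map_linearMap_addHaar_eq_smul_addHaar
      (volume : Measure (EuclideanSpace ℝ ι)) (f := (L : EuclideanSpace ℝ ι →ₗ[ℝ] _))
      (by rw [hdet]; exact hpos.ne')
    rwa [hdet, abs_of_pos (inv_pos.2 hpos)] at this
  have hLm : Measurable L := L.continuous.measurable
  have hw := measurable_whiteningDensity S
  ext s hs
  have hpt : ∀ z : EuclideanSpace ℝ ι, ENNReal.ofReal (φ z) *
      s.indicator (fun x => ENNReal.ofReal (whiteningDensity S x)) (L z) =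
      ENNReal.ofReal (CFC.sqrt S).det * s.indicator (fun x => ENNReal.ofReal (φ x)) (L z) := by
    intro z
    by_cases hz : L z ∈ s
    · rw [Set.indicator_of_mem hz, Set.indicator_of_mem hz, ← ENNReal.ofReal_mul (by positivity),
        ← ENNReal.ofReal_mul hpos.le, whiteningDensity, hL, toEuclideanCLM_inv_sqrt_apply hS]
      congr 1
      simp only [hφ]
      rw [mul_mul_mul_comm, ← Real.exp_add, ← mul_assoc, mul_comm (CFC.sqrt S).det]
      congr 2
      ring
    · simp [Set.indicator_of_notMem hz]
  rw [withDensity_apply _ hs, ← lintegral_indicator hs, multivariateGaussian_zero_eq_map,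
    lintegral_map ((by fun_prop : Measurable _).indicator hs) hLm]
  have hi : Measurable fun z =>
      s.indicator (fun x => ENNReal.ofReal (whiteningDensity S x)) (L z) :=
    ((by fun_prop : Measurable fun x => ENNReal.ofReal (whiteningDensity S x)).indicator hs).comp
      hLm
  rw [stdGaussian_eq_withDensity, lintegral_withDensity_eq_lintegral_mul _ (by fun_prop) hi]
  simp only [Pi.mul_apply]
  have hi' : Measurable (s.indicator fun x => ENNReal.ofReal (φ x)) :=
    (by fun_prop : Measurable fun x => ENNReal.ofReal (φ x)).indicator hs
  rw [lintegral_congr hpt, lintegral_const_mul _ (by exact hi'.comp hLm), ← lintegral_map hi' hLm,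
    hmap, lintegral_smul_measure, smul_eq_mul, ← mul_assoc, ← ENNReal.ofReal_mul hpos.le,
    mul_inv_cancel₀ hpos.ne', ENNReal.ofReal_one, one_mul, lintegral_indicator hs,
    withDensity_apply _ hs]

lemma log_whiteningDensity {S : Matrix ι ι ℝ} (hS : S.PosDef) (x : EuclideanSpace ℝ ι) :
    Real.log (whiteningDensity S x) = Real.log S.det / 2 +
      (‖Matrix.toEuclideanCLM (𝕜 := ℝ) (CFC.sqrt S)⁻¹ x‖ ^ 2 / 2 - ‖x‖ ^ 2 / 2) := by
  rw [whiteningDensity, Real.log_mul (det_sqrt_pos hS).ne' (Real.exp_pos _).ne', Real.log_exp,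
    log_det_sqrt hS]

lemma integrable_norm_sq_whitened {S : Matrix ι ι ℝ} (hS : S.PosDef) :
    Integrable (fun x => ‖Matrix.toEuclideanCLM (𝕜 := ℝ) (CFC.sqrt S)⁻¹ x‖ ^ 2)
      (multivariateGaussian 0 S) := by
  rw [multivariateGaussian_zero_eq_map, integrable_map_measure (by fun_prop) (by fun_prop)]
  simpa only [Function.comp_def, toEuclideanCLM_inv_sqrt_apply hS, multivariateGaussian_zero_one]
    using integrable_norm_sq_multivariateGaussian (1 : Matrix ι ι ℝ)

lemma integral_norm_sq_whitened {S : Matrix ι ι ℝ} (hS : S.PosDef) :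
    ∫ x, ‖Matrix.toEuclideanCLM (𝕜 := ℝ) (CFC.sqrt S)⁻¹ x‖ ^ 2 ∂multivariateGaussian 0 S =
      Fintype.card ι := by
  rw [multivariateGaussian_zero_eq_map, integral_map (by fun_prop) (by fun_prop)]
  simp only [toEuclideanCLM_inv_sqrt_apply hS]
  rw [← multivariateGaussian_zero_one,
    integral_norm_sq_multivariateGaussian Matrix.PosSemidef.one, Matrix.trace_one]

lemma integrable_log_whiteningDensity {S : Matrix ι ι ℝ} (hS : S.PosDef) :
    Integrable (fun x => Real.log (whiteningDensity S x)) (multivariateGaussian 0 S) := by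
  simp_rw [log_whiteningDensity hS]
  exact (integrable_const _).add (((integrable_norm_sq_whitened hS).div_const 2).sub
    ((integrable_norm_sq_multivariateGaussian S).div_const 2))

/-- For unit variances the quadratic terms cancel, and the relative entropy of `N(0, S)` with
respect to white noise is `-log (det S) / 2`. -/
lemma integral_log_whiteningDensity {S : Matrix ι ι ℝ} (hS : S.PosDef) (hdiag : ∀ i, S i i = 1) :
    ∫ x, Real.log (whiteningDensity S x) ∂multivariateGaussian 0 S = Real.log S.det / 2 := by
  simp_rw [log_whiteningDensity hS]
  have h1 := (integrable_norm_sq_whitened hS).div_const 2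
  have h2 := (integrable_norm_sq_multivariateGaussian S).div_const 2
  have htr : S.trace = Fintype.card ι := by simp [Matrix.trace, hdiag]
  rw [integral_add (integrable_const _) (by exact h1.sub h2), integral_sub h1 h2, integral_div,
    integral_div, integral_div, integral_norm_sq_whitened hS,
    integral_norm_sq_multivariateGaussian hS.posSemidef, htr]
  simp

end WhiteNoise

/-! ### Fano's inequality for decoders -/

/-- Fano's inequality. If all laws `P a` are within relative entropy `D` of a common law `Q`, then
`n` samples do not allow all of them to be recognised, by disjoint events, with probability above
`t`: one of the events has `Q`-probability at most `1 / card κ`. -/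
lemma exists_measureReal_pi_le {κ α : Type*} [Fintype κ] [Nonempty κ] [MeasurableSpace α]
    {P : κ → Measure α} {Q : Measure α} [∀ a, IsProbabilityMeasure (P a)] [IsProbabilityMeasure Q]
    {w : κ → α → ℝ} (hw : ∀ a, Measurable (w a)) (hpos : ∀ a x, 0 < w a x)
    (hQ : ∀ a, Q = (P a).withDensity fun x => ENNReal.ofReal (w a x))
    (hint : ∀ a, Integrable (fun x => Real.log (w a x)) (P a)) {D : ℝ}
    (hD : ∀ a, -∫ x, Real.log (w a x) ∂P a ≤ D) {n : ℕ} {A : κ → Set (Fin n → α)}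
    (hA : ∀ a, MeasurableSet (A a)) (hdisj : Pairwise (Function.onFun Disjoint A)) {t : ℝ}
    (ht : n * D + Real.log 2 ≤ t * Real.log (Fintype.card κ)) :
    ∃ a, (Measure.pi fun _ : Fin n => P a).real (A a) ≤ t := by
  set Qn := Measure.pi fun _ : Fin n => Q
  set M : ℝ := (Fintype.card κ : ℝ) with hM
  have hM1 : 1 ≤ M := by rw [hM]; exact_mod_cast Fintype.card_pos
  have hM0 : 0 < M := by linarith
  obtain ⟨a, ha⟩ : ∃ a, Qn.real (A a) ≤ M⁻¹ := by
    by_contra! hcon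
    have h1 : ∑ a, Qn.real (A a) ≤ 1 := by
      rw [← measureReal_iUnion_fintype hdisj hA]
      exact measureReal_le_one
    have h2 : ∑ _a : κ, M⁻¹ < ∑ a, Qn.real (A a) :=
      Finset.sum_lt_sum_of_nonempty Finset.univ_nonempty fun a _ => hcon a
    rw [Finset.sum_const, Finset.card_univ, nsmul_eq_mul, ← hM, mul_inv_cancel₀ hM0.ne'] at h2
    linarith
  refine ⟨a, ?_⟩
  have h := measureReal_pi_mul_log_le (hw a) (hpos a) (hQ a) (hint a) n (hA a) hM1
  have hq : 1 + (M - 1) * Qn.real (A a) < 2 := by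
    have : (M - 1) * Qn.real (A a) ≤ (M - 1) * M⁻¹ :=
      mul_le_mul_of_nonneg_left ha (by linarith)
    rw [sub_mul M 1 M⁻¹, mul_inv_cancel₀ hM0.ne', one_mul] at this
    have := inv_pos.2 hM0
    linarith
  have hq0 : 0 < 1 + (M - 1) * Qn.real (A a) := by
    have : 0 ≤ (M - 1) * Qn.real (A a) := mul_nonneg (by linarith) measureReal_nonneg
    linarith
  have hlog := Real.log_lt_log hq0 hq
  have hn : (n : ℝ) * -∫ x, Real.log (w a x) ∂P a ≤ n * D :=
    mul_le_mul_of_nonneg_left (hD a) (Nat.cast_nonneg n)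
  have : (Measure.pi fun _ : Fin n => P a).real (A a) * Real.log M < t * Real.log M := by
    linarith
  exact (lt_of_mul_lt_mul_right this (Real.log_nonneg hM1)).le

namespace LatentTree

variable {o : ℕ}

lemma Same.symm {T T' : LatentTree o} (h : T.Same T') : T'.Same T := by
  obtain ⟨f, hf⟩ := h
  exact ⟨f.symm, fun i => by rw [← hf i]; exact f.symm_apply_apply _⟩

lemma Same.trans {T T' T'' : LatentTree o} (h : T.Same T') (h' : T'.Same T'') : T.Same T'' := by
  obtain ⟨f, hf⟩ := h
  obtain ⟨g, hg⟩ := h'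
  exact ⟨f.trans g, fun i => by simp [hf, hg]⟩

end LatentTree

/-- A decoder of the observed variables can be run on samples of all nodes. -/
lemma LatentTreeModel.errorProb_eq {o l n : ℕ} {ρmax : ℝ} (θ : LatentTreeModel o l ρmax)
    {φ : (Fin n → Fin o × Fin l → ℝ) → LatentTree o} (hφ : Measurable φ) :
    θ.errorProb φ = 1 - (Measure.pi fun _ : Fin n => multivariateGaussian 0 θ.cov).real
      {X | (φ fun k q => X k (Sum.inl q.1, q.2)).Same θ.tree} := by
  have hg : Measurable fun (x : EuclideanSpace ℝ (θ.tree.Node × Fin l)) (q : Fin o × Fin l) =>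
      x (Sum.inl q.1, q.2) := by fun_prop
  have hsame : MeasurableSet {X | (φ X).Same θ.tree} :=
    hφ (show MeasurableSet {T : LatentTree o | T.Same θ.tree} from trivial)
  have hpi : (Measure.pi fun _ : Fin n => θ.obsLaw) =
      (Measure.pi fun _ : Fin n => multivariateGaussian 0 θ.cov).map
        fun X k q => X k (Sum.inl q.1, q.2) :=
    (Measure.pi_map_pi (μ := fun _ : Fin n => multivariateGaussian 0 θ.cov)
      fun _ => hg.aemeasurable).symm
  have hcompl : {X | ¬ (φ X).Same θ.tree} = {X | (φ X).Same θ.tree}ᶜ := rfl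
  rw [LatentTreeModel.errorProb, hcompl, probReal_compl_eq_one_sub hsame, hpi,
    map_measureReal_apply (by fun_prop) hsame]
  rfl

/-! ### Gaussian variables on a rooted tree -/

namespace RootedTree

variable {V : Type*} {p : V → V} {root : V} {h : V → ℕ}

/-- The graph that joins each node other than `root` to its parent `p i`; the value `p root` is
ignored. -/
def graph (p : V → V) (root : V) : SimpleGraph V :=
  SimpleGraph.fromRel fun i j => i ≠ root ∧ p i = j

lemma graph_adj {i j : V} : (graph p root).Adj i j ↔
    i ≠ j ∧ (i ≠ root ∧ p i = j ∨ j ≠ root ∧ p j = i) :=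
  SimpleGraph.fromRel_adj _ _ _

lemma graph_adj_parent (hh : ∀ i, i ≠ root → h (p i) < h i) {i : V} (hi : i ≠ root) :
    (graph p root).Adj i (p i) :=
  graph_adj.2 ⟨fun e => (hh i hi).ne (congrArg h e.symm), Or.inl ⟨hi, rfl⟩⟩

lemma root_lt (hh : ∀ i, i ≠ root → h (p i) < h i) : ∀ {i : V}, i ≠ root → h root < h i := by
  have : ∀ k i, h i = k → i ≠ root → h root < h i := by
    intro k
    induction k using Nat.strong_induction_on with
    | _ k ih =>
      intro i hik hi
      by_cases hp : p i = root
      · exact hp ▸ hh i hi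
      · exact (ih _ (hik ▸ hh i hi) (p i) rfl hp).trans (hh i hi)
  exact fun {i} hi => this _ i rfl hi

variable [DecidableEq V]

/-- The variances of the innovations `x i - r * x (p i)`, chosen such that each node has
variance one. -/
def noise (root : V) (r : ℝ) (i : V) : ℝ := if i = root then 1 else 1 - r ^ 2

lemma noise_pos (root : V) {r : ℝ} (h0 : 0 < r) (h1 : r < 1) (i : V) : 0 < noise root r i := by
  unfold noise
  split_ifs
  · exact one_pos
  · nlinarith

variable [Fintype V]

lemma isTree_graph (hh : ∀ i, i ≠ root → h (p i) < h i) : (graph p root).IsTree := by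
  rw [SimpleGraph.isTree_iff_connected_and_card]
  constructor
  · have hreach : ∀ k i, h i = k → (graph p root).Reachable i root := by
      intro k
      induction k using Nat.strong_induction_on with
      | _ k ih =>
        intro i hik
        by_cases hi : i = root
        · rw [hi]
        · exact (graph_adj_parent hh hi).reachable.trans
            (ih _ (hik ▸ hh i hi) (p i) rfl)
    have : Nonempty V := ⟨root⟩
    exact ⟨fun i j => (hreach _ i rfl).trans (hreach _ j rfl).symm⟩
  · have hbij : Function.Bijective fun i : {i : V // i ≠ root} =>
        (⟨s(i.1, p i.1), graph_adj_parent hh i.2⟩ : (graph p root).edgeSet) := by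
      constructor
      · rintro ⟨i, hi⟩ ⟨j, hj⟩ hij
        rw [Subtype.mk.injEq]
        rcases Sym2.eq_iff.1 (congrArg Subtype.val hij) with ⟨e, -⟩ | ⟨e1, e2⟩
        · exact e
        · have h1 : h j < h i := (congrArg h e2) ▸ hh i hi
          have h2 : h i < h j := (congrArg h e1) ▸ hh j hj
          omega
      · rintro ⟨e, he⟩
        induction e using Sym2.ind with
        | _ i j =>
          rcases (graph_adj.1 he).2 with ⟨hi, e⟩ | ⟨hj, e⟩
          · exact ⟨⟨i, hi⟩, by simp [e]⟩
          · exact ⟨⟨j, hj⟩, by simp [e, Sym2.eq_swap]⟩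
    rw [← Nat.card_congr (Equiv.ofBijective _ hbij), Nat.card_eq_fintype_card,
      Nat.card_eq_fintype_card, Fintype.card_subtype_compl, Fintype.card_subtype_eq]
    exact Nat.sub_add_cancel (Fintype.card_pos_iff.2 ⟨root⟩)

/-- The matrix that takes the variables of the nodes to their innovations
`x i - r * x (p i)`. -/
def innovation (p : V → V) (root : V) (r : ℝ) : Matrix V V ℝ :=
  1 - r • Matrix.of fun i j => if i ≠ root ∧ p i = j then 1 else 0

/-- The covariance matrix of the Gaussian variables whose innovations along the tree are
independent with variances `noise root r`. -/
noncomputable def cov (p : V → V) (root : V) (r : ℝ) : Matrix V V ℝ :=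
  (innovation p root r)⁻¹ * Matrix.diagonal (noise root r) * ((innovation p root r)⁻¹)ᵀ

lemma innovation_mul_apply (r : ℝ) (X : Matrix V V ℝ) (i j : V) :
    (innovation p root r * X) i j = X i j - if i = root then 0 else r * X (p i) j := by
  rw [innovation, Matrix.sub_mul, one_mul, Matrix.sub_apply, Matrix.smul_mul, Matrix.smul_apply,
    Matrix.mul_apply]
  by_cases hi : i = root <;> simp [hi]

lemma det_innovation (hh : ∀ i, i ≠ root → h (p i) < h i) (r : ℝ) :
    (innovation p root r).det = 1 := by
  have htri : (innovation p root r).BlockTriangular fun i => OrderDual.toDual (h i) := by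
    intro i j hij
    have hlt : h i < h j := hij
    have hne : i ≠ j := fun e => by simp [e] at hlt
    have : ¬ (i ≠ root ∧ p i = j) := by
      rintro ⟨hi, e⟩
      have := hh i hi
      rw [e] at this
      omega
    simp [innovation, hne, this]
  rw [htri.det]
  refine Finset.prod_eq_one fun a _ => ?_
  have : (innovation p root r).toSquareBlock (fun i => OrderDual.toDual (h i)) a = 1 := by
    ext ⟨i, hi⟩ ⟨j, hj⟩
    have hij : h i = h j := OrderDual.toDual.injective (hi.trans hj.symm)
    have : ¬ (i ≠ root ∧ p i = j) := by
      rintro ⟨hi, e⟩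
      have := hh i hi
      rw [e] at this
      omega
    simp [innovation, Matrix.toSquareBlock_def, this, Matrix.one_apply]
  rw [this, Matrix.det_one]

lemma isUnit_det_innovation (hh : ∀ i, i ≠ root → h (p i) < h i) (r : ℝ) :
    IsUnit (innovation p root r).det := by
  rw [det_innovation hh]
  exact isUnit_one

lemma inv_innovation_apply (hh : ∀ i, i ≠ root → h (p i) < h i) (r : ℝ) (i j : V) :
    (innovation p root r)⁻¹ i j =
      (if i = j then 1 else 0) + if i = root then 0 else r * (innovation p root r)⁻¹ (p i) j := by
  have := innovation_mul_apply (p := p) (root := root) r (innovation p root r)⁻¹ i j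
  rw [Matrix.mul_nonsing_inv _ (isUnit_det_innovation hh r), Matrix.one_apply] at this
  linarith

/-- A node depends on the innovations of its ancestors only. -/
lemma inv_innovation_apply_eq_zero (hh : ∀ i, i ≠ root → h (p i) < h i) (r : ℝ) {i j : V}
    (hij : i ≠ j) (hle : h i ≤ h j) : (innovation p root r)⁻¹ i j = 0 := by
  have : ∀ k i, h i = k → i ≠ j → h i ≤ h j → (innovation p root r)⁻¹ i j = 0 := by
    intro k
    induction k using Nat.strong_induction_on with
    | _ k ih =>
      intro i hik hij hle
      rw [inv_innovation_apply hh, if_neg hij, zero_add]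
      split_ifs with hi
      · rfl
      · have hlt := hh i hi
        rw [ih _ (hik ▸ hlt) (p i) rfl (fun e => by rw [e] at hlt; omega) (by omega), mul_zero]
  exact this _ i rfl hij hle

lemma inv_innovation_apply_self (hh : ∀ i, i ≠ root → h (p i) < h i) (r : ℝ) (i : V) :
    (innovation p root r)⁻¹ i i = 1 := by
  rw [inv_innovation_apply hh, if_pos rfl]
  split_ifs with hi
  · simp
  · have hlt := hh i hi
    rw [inv_innovation_apply_eq_zero hh r (fun e => by rw [e] at hlt; omega) hlt.le]
    simp

lemma cov_comm (p : V → V) (root : V) (r : ℝ) (i j : V) : cov p root r i j = cov p root r j i := by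
  have : (cov p root r)ᵀ = cov p root r := by
    simp [cov, Matrix.transpose_mul, Matrix.mul_assoc]
  rw [← Matrix.transpose_apply (cov p root r), this]

lemma cov_apply (hh : ∀ i, i ≠ root → h (p i) < h i) (r : ℝ) (i j : V) :
    cov p root r i j = (if i = root then 0 else r * cov p root r (p i) j) +
      noise root r i * (innovation p root r)⁻¹ j i := by
  have h1 := innovation_mul_apply (p := p) (root := root) r (cov p root r) i j
  have h2 : innovation p root r * cov p root r =
      Matrix.diagonal (noise root r) * ((innovation p root r)⁻¹)ᵀ := by
    rw [cov, ← Matrix.mul_assoc, ← Matrix.mul_assoc,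
      Matrix.mul_nonsing_inv _ (isUnit_det_innovation hh r), Matrix.one_mul]
  rw [h2, Matrix.diagonal_mul, Matrix.transpose_apply] at h1
  linarith

/-- The covariance with a node that is not below `i` passes through the parent of `i`. -/
lemma cov_parent (hh : ∀ i, i ≠ root → h (p i) < h i) (r : ℝ) {i j : V} (hij : i ≠ j)
    (hle : h j ≤ h i) : cov p root r i j = r * cov p root r (p i) j := by
  have hi : i ≠ root := by
    rintro rfl
    have := root_lt hh hij.symm
    omega
  rw [cov_apply hh, if_neg hi, inv_innovation_apply_eq_zero hh r hij.symm hle]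
  simp

lemma cov_self (hh : ∀ i, i ≠ root → h (p i) < h i) (r : ℝ) (i : V) : cov p root r i i = 1 := by
  have : ∀ k i, h i = k → cov p root r i i = 1 := by
    intro k
    induction k using Nat.strong_induction_on with
    | _ k ih =>
      intro i hik
      rw [cov_apply hh, inv_innovation_apply_self hh]
      by_cases hi : i = root
      · simp [hi, noise]
      · have hlt := hh i hi
        have hne : i ≠ p i := fun e => by rw [← e] at hlt; omega
        rw [cov_comm, cov_parent hh r hne hlt.le, ih _ (hik ▸ hlt) (p i) rfl, noise, if_neg hi,
          if_neg hi]
        ring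
  exact this _ i rfl

/-- The covariance of two nodes is a power of `r`; the exponent is their distance in the tree, of
which only the bound by the path through the root is recorded. -/
lemma exists_cov_eq_pow (hh : ∀ i, i ≠ root → h (p i) < h i) (r : ℝ) {i j : V} (hij : i ≠ j) :
    ∃ m, 1 ≤ m ∧ m ≤ h i + h j ∧ cov p root r i j = r ^ m := by
  have : ∀ k i j, h i + h j = k → i ≠ j → ∃ m, 1 ≤ m ∧ m ≤ h i + h j ∧
      cov p root r i j = r ^ m := by
    intro k
    induction k using Nat.strong_induction_on with
    | _ k ih =>
      have aux : ∀ i j, h i + h j = k → i ≠ j → h j ≤ h i → ∃ m, 1 ≤ m ∧ m ≤ h i + h j ∧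
          cov p root r i j = r ^ m := by
        intro i j hk hij hle
        have hi : i ≠ root := by
          rintro rfl
          have := root_lt hh hij.symm
          omega
        have hlt := hh i hi
        rw [cov_parent hh r hij hle]
        by_cases hp : p i = j
        · exact ⟨1, le_rfl, by omega, by rw [hp, cov_self hh]; ring⟩
        · obtain ⟨m, -, hm, e⟩ := ih _ (by omega) (p i) j rfl hp
          exact ⟨m + 1, by omega, by omega, by rw [e]; ring⟩
      intro i j hk hij
      rcases le_total (h j) (h i) with hle | hle
      · exact aux i j hk hij hle
      · obtain ⟨m, h1, h2, e⟩ := aux j i (by omega) hij.symm hle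
        exact ⟨m, h1, by omega, by rw [cov_comm, e]⟩
  exact this _ i j rfl hij

lemma cov_siblings (hh : ∀ i, i ≠ root → h (p i) < h i) (r : ℝ) {i j : V} (hij : i ≠ j)
    (hj : j ≠ root) (hp : p i = p j) (hle : h j ≤ h i) : cov p root r i j = r ^ 2 := by
  have hlt := hh j hj
  have hne : j ≠ p j := fun e => by rw [← e] at hlt; omega
  rw [cov_parent hh r hij hle, hp, cov_comm, cov_parent hh r hne hlt.le, cov_self hh]
  ring

lemma posDef_cov (hh : ∀ i, i ≠ root → h (p i) < h i) {r : ℝ} (h0 : 0 < r) (h1 : r < 1) :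
    (cov p root r).PosDef := by
  have hd : (Matrix.diagonal (noise root r)).PosDef :=
    Matrix.PosDef.diagonal (noise_pos root h0 h1)
  have hu : IsUnit (innovation p root r)⁻¹ :=
    (Matrix.isUnit_nonsing_inv_iff).2
      ((Matrix.isUnit_iff_isUnit_det _).2 (isUnit_det_innovation hh r))
  have := hd.mul_mul_conjTranspose_same (Matrix.vecMul_injective_of_isUnit hu)
  rwa [Matrix.conjTranspose_eq_transpose_of_trivial] at this

lemma det_cov (hh : ∀ i, i ≠ root → h (p i) < h i) (r : ℝ) :
    (cov p root r).det = (1 - r ^ 2) ^ (Fintype.card V - 1) := by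
  rw [cov, Matrix.det_mul, Matrix.det_mul, Matrix.det_transpose, Matrix.det_nonsing_inv,
    det_innovation hh, Ring.inverse_one, one_mul, mul_one, Matrix.det_diagonal,
    ← Finset.mul_prod_erase _ _ (Finset.mem_univ root)]
  rw [Finset.prod_congr rfl fun i hi => show noise root r i = 1 - r ^ 2 from
      if_neg (Finset.ne_of_mem_erase hi), Finset.prod_const,
    Finset.card_erase_of_mem (Finset.mem_univ root), Finset.card_univ]
  simp [noise]

lemma inv_cov (hh : ∀ i, i ≠ root → h (p i) < h i) {r : ℝ} (h0 : 0 < r) (h1 : r < 1) :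
    (cov p root r)⁻¹ = (innovation p root r)ᵀ *
      (Matrix.diagonal (fun i => (noise root r i)⁻¹) * innovation p root r) := by
  have hu := isUnit_det_innovation hh r
  have hd : (Matrix.diagonal (noise root r))⁻¹ = Matrix.diagonal fun i => (noise root r i)⁻¹ := by
    refine Matrix.inv_eq_right_inv ?_
    rw [Matrix.diagonal_mul_diagonal, ← Matrix.diagonal_one]
    congr 1
    ext i
    exact mul_inv_cancel₀ (noise_pos root h0 h1 i).ne'
  rw [cov, Matrix.mul_inv_rev, Matrix.mul_inv_rev, hd, Matrix.nonsing_inv_nonsing_inv _ hu,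
    ← Matrix.transpose_nonsing_inv, Matrix.nonsing_inv_nonsing_inv _ hu]

/-- The edges of the tree are the nonzero entries of the precision matrix. -/
lemma inv_cov_apply_ne_zero_iff (hh : ∀ i, i ≠ root → h (p i) < h i) {r : ℝ} (h0 : 0 < r)
    (h1 : r < 1) {i j : V} (hij : i ≠ j) :
    (cov p root r)⁻¹ i j ≠ 0 ↔ (graph p root).Adj i j := by
  have hentry : ∀ k, (innovation p root r) k i * ((noise root r k)⁻¹ * innovation p root r k j) =
      -(if k = i then if i ≠ root ∧ p i = j then r * (noise root r i)⁻¹ else 0 else 0) -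
      if k = j then if j ≠ root ∧ p j = i then r * (noise root r j)⁻¹ else 0 else 0 := by
    intro k
    have hloop : ∀ i, i ≠ root → p i ≠ i := fun i hi e => (hh i hi).ne (congrArg h e)
    have hji := hij.symm
    by_cases hki : k = i
    · subst hki
      have hc : ¬ (k ≠ root ∧ p k = k) := fun c => hloop k c.1 c.2
      by_cases c1 : k ≠ root ∧ p k = j <;> simp [innovation, hc, hij, hji, c1, mul_comm]
    · by_cases hkj : k = j
      · subst hkj
        have hc : ¬ (k ≠ root ∧ p k = k) := fun c => hloop k c.1 c.2
        by_cases c1 : k ≠ root ∧ p k = i <;> simp [innovation, hc, hij, hji, c1, mul_comm]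
      · have hc : ¬ (k ≠ root ∧ p k = i) ∨ ¬ (k ≠ root ∧ p k = j) := by
          by_contra! hc
          exact hij (hc.1.2.symm.trans hc.2.2)
        rcases hc with hc | hc <;> simp [innovation, hc, hki, hkj]
  have hval : (cov p root r)⁻¹ i j =
      -(if i ≠ root ∧ p i = j then r * (noise root r i)⁻¹ else 0) -
      if j ≠ root ∧ p j = i then r * (noise root r j)⁻¹ else 0 := by
    rw [inv_cov hh h0 h1, Matrix.mul_apply]
    simp_rw [Matrix.transpose_apply, Matrix.diagonal_mul, hentry]
    rw [Finset.sum_sub_distrib, Finset.sum_neg_distrib, Finset.sum_ite_eq' Finset.univ i,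
      Finset.sum_ite_eq' Finset.univ j]
    simp
  have hi : 0 < r * (noise root r i)⁻¹ := mul_pos h0 (inv_pos.2 (noise_pos root h0 h1 i))
  have hj : 0 < r * (noise root r j)⁻¹ := mul_pos h0 (inv_pos.2 (noise_pos root h0 h1 j))
  rw [hval, graph_adj]
  by_cases c1 : i ≠ root ∧ p i = j
  · rw [if_pos c1]
    have : 0 ≤ if j ≠ root ∧ p j = i then r * (noise root r j)⁻¹ else 0 := by
      split_ifs <;> linarith
    exact ⟨fun _ => ⟨hij, Or.inl c1⟩, fun _ => by linarith⟩
  · rw [if_neg c1]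
    by_cases c2 : j ≠ root ∧ p j = i
    · rw [if_pos c2]
      exact ⟨fun _ => ⟨hij, Or.inr c2⟩, fun _ => by linarith⟩
    · rw [if_neg c2]
      simp only [neg_zero, sub_zero, ne_eq, not_true_eq_false, false_iff]
      exact fun h => h.2.elim c1 c2

end RootedTree

/-! ### Information distances of scalar correlations -/

open scoped Kronecker

lemma singularValueProd_eq_abs_det {l : ℕ} (M : Matrix (Fin l) (Fin l) ℝ) :
    singularValueProd M = |M.det| := by
  have h := (Matrix.toEuclideanLin M).normDet_eq_prod_singularValues
  rw [LinearMap.normDet_eq_abs_det, Matrix.toEuclideanLin, Matrix.toLpLin_eq_toLin,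
    LinearMap.det_toLin, finrank_euclideanSpace_fin] at h
  exact h.symm

lemma nodeBlock_kronecker_one {V : Type*} {l : ℕ} (S : Matrix V V ℝ) (i j : V) :
    nodeBlock (S ⊗ₖ (1 : Matrix (Fin l) (Fin l) ℝ)) i j = S i j • 1 := by
  ext s t
  simp [nodeBlock]

lemma informationDistance_kronecker_one {V : Type*} {l : ℕ} {S : Matrix V V ℝ}
    (hdiag : ∀ i, S i i = 1) {r : ℝ} (hr : 0 < r) {i j : V} {m : ℕ} (hij : S i j = r ^ m) :
    informationDistance (S ⊗ₖ (1 : Matrix (Fin l) (Fin l) ℝ)) i j =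
      m * (l * -Real.log r) := by
  rw [informationDistance, singularValueProd_eq_abs_det]
  simp only [nodeBlock_kronecker_one, hdiag, hij, one_smul, Matrix.det_one, Matrix.det_smul,
    Fintype.card_fin, mul_one, Real.sqrt_one, div_one]
  rw [abs_of_pos (by positivity), ← pow_mul, Real.log_pow]
  push_cast
  ring

/-! ### Trees with one hidden root -/

namespace HiddenRoot

variable {o : ℕ}

/-- The map to the parents, when the hidden node `Sum.inr 0` is the root and `q` gives the parents
of the observed nodes. -/
def parent (q : Fin o → Fin o ⊕ Fin 1) : Fin o ⊕ Fin 1 → Fin o ⊕ Fin 1 :=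
  Sum.elim q fun _ => Sum.inr 0

/-- The depth of a node, in trees of depth at most two. -/
def depth (q : Fin o → Fin o ⊕ Fin 1) : Fin o ⊕ Fin 1 → ℕ :=
  Sum.elim (fun i => if q i = Sum.inr 0 then 1 else 2) fun _ => 0

lemma depth_le_two (q : Fin o → Fin o ⊕ Fin 1) (i : Fin o ⊕ Fin 1) : depth q i ≤ 2 := by
  rcases i with i | i
  · simp only [depth, Sum.elim_inl]
    split_ifs <;> omega
  · simp [depth]

/-- The parent maps for which the first `m` observed nodes are children of the hidden root and the
others choose their parents in `C`. -/
def attachments (o m : ℕ) (C : Finset (Fin o ⊕ Fin 1)) : Finset (Fin o → Fin o ⊕ Fin 1) :=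
  Fintype.piFinset fun i => if (i : ℕ) < m then {Sum.inr 0} else C

variable {m : ℕ} {C : Finset (Fin o ⊕ Fin 1)} {q : Fin o → Fin o ⊕ Fin 1}

lemma card_attachments (hm : m ≤ o) (C : Finset (Fin o ⊕ Fin 1)) :
    (attachments o m C).card = C.card ^ (o - m) := by
  have hcard : (Finset.univ.filter fun i : Fin o => ¬ (i : ℕ) < m).card = o - m := by
    rw [← Finset.compl_filter, Finset.card_compl, Fin.card_filter_val_lt, Fintype.card_fin,
      min_eq_right hm]
  rw [attachments, Fintype.card_piFinset]
  simp_rw [apply_ite Finset.card, Finset.card_singleton]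
  rw [Finset.prod_ite, Finset.prod_const_one, one_mul, Finset.prod_const, hcard]

lemma eq_root_of_mem_attachments (hq : q ∈ attachments o m C) {i : Fin o} (hi : (i : ℕ) < m) :
    q i = Sum.inr 0 := by
  have := Fintype.mem_piFinset.1 hq i
  simpa [hi] using this

lemma mem_of_mem_attachments (hq : q ∈ attachments o m C) {i : Fin o} (hi : ¬ (i : ℕ) < m) :
    q i ∈ C := by
  have := Fintype.mem_piFinset.1 hq i
  simpa [hi] using this

lemma depth_parent_lt (hC : ∀ c ∈ C, c = Sum.inr 0 ∨ ∃ j : Fin o, (j : ℕ) < m ∧ c = Sum.inl j)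
    (hq : q ∈ attachments o m C) (i : Fin o ⊕ Fin 1) (hi : i ≠ Sum.inr 0) :
    depth q (parent q i) < depth q i := by
  rcases i with i | i
  · by_cases hr : q i = Sum.inr 0
    · simp [depth, parent, hr]
    · have him : ¬ (i : ℕ) < m := fun h => hr (eq_root_of_mem_attachments hq h)
      obtain ⟨j, hj, e⟩ := (hC _ (mem_of_mem_attachments hq him)).resolve_left hr
      simp [depth, parent, e, eq_root_of_mem_attachments hq hj]
  · exact absurd (by rw [Subsingleton.elim i 0]) hi

/-- Two nodes below the same child of the root have distance two, so if only one child of the root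
has children of its own, no distance exceeds three. -/
lemma exists_cov_eq_pow
    (hC : ∀ c ∈ C, c = Sum.inr 0 ∨ ∃ j : Fin o, (j : ℕ) < m ∧ c = Sum.inl j)
    (hq : q ∈ attachments o m C) {D : ℕ} (hD : 3 ≤ D)
    (hD' : 4 ≤ D ∨ ∀ c ∈ C, ∀ c' ∈ C, c ≠ Sum.inr 0 → c' ≠ Sum.inr 0 → c = c')
    (r : ℝ) {i j : Fin o ⊕ Fin 1} (hij : i ≠ j) :
    ∃ k, 1 ≤ k ∧ k ≤ D ∧ RootedTree.cov (parent q) (Sum.inr 0) r i j = r ^ k := by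
  have hh := depth_parent_lt hC hq
  by_cases hdepth : depth q i + depth q j ≤ D
  · obtain ⟨k, h1, h2, e⟩ := RootedTree.exists_cov_eq_pow hh r hij
    exact ⟨k, h1, h2.trans hdepth, e⟩
  · have hi2 := depth_le_two q i
    have hj2 := depth_le_two q j
    have hroot : ∀ x, depth q x = 2 → ∃ a, x = Sum.inl a ∧ q a ≠ Sum.inr 0 ∧ q a ∈ C := by
      rintro (a | a) hx
      · have ha : q a ≠ Sum.inr 0 := fun h => by simp [depth, h] at hx
        exact ⟨a, rfl, ha,
          mem_of_mem_attachments hq fun h => ha (eq_root_of_mem_attachments hq h)⟩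
      · simp [depth] at hx
    obtain ⟨a, rfl, ha, haC⟩ := hroot i (by omega)
    obtain ⟨b, rfl, hb, hbC⟩ := hroot j (by omega)
    have hab : q a = q b := hD'.resolve_left (by omega) _ haC _ hbC ha hb
    exact ⟨2, by omega, by omega,
      RootedTree.cov_siblings hh r hij (by simp) hab (by omega)⟩

/-- The latent tree with one hidden node, its root, in which `q` gives the parents of the observed
nodes. -/
def latentTree (q : Fin o → Fin o ⊕ Fin 1)
    (hh : ∀ i, i ≠ Sum.inr 0 → depth q (parent q i) < depth q i) : LatentTree o where
  numHidden := 1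
  graph := RootedTree.graph (parent q) (Sum.inr 0)
  isTree := RootedTree.isTree_graph hh

/-- The covariance matrix of all coordinates, when the correlation along each edge is `r` times the
identity. -/
noncomputable abbrev vectorCov (l : ℕ) (q : Fin o → Fin o ⊕ Fin 1) (r : ℝ) :
    Matrix ((Fin o ⊕ Fin 1) × Fin l) ((Fin o ⊕ Fin 1) × Fin l) ℝ :=
  RootedTree.cov (parent q) (Sum.inr 0) r ⊗ₖ (1 : Matrix (Fin l) (Fin l) ℝ)

lemma graph_adj_iff_nodeBlock_ne_zero {l : ℕ} (hl : 1 ≤ l)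
    (hh : ∀ i, i ≠ Sum.inr 0 → depth q (parent q i) < depth q i) {r : ℝ} (h0 : 0 < r) (h1 : r < 1)
    {i j : Fin o ⊕ Fin 1} (hij : i ≠ j) :
    (RootedTree.graph (parent q) (Sum.inr 0)).Adj i j ↔ nodeBlock (vectorCov l q r)⁻¹ i j ≠ 0 := by
  have : NeZero l := ⟨by omega⟩
  rw [vectorCov, Matrix.inv_kronecker, inv_one, nodeBlock_kronecker_one, smul_ne_zero_iff,
    RootedTree.inv_cov_apply_ne_zero_iff hh h0 h1 hij]
  exact (and_iff_left one_ne_zero).symm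

/-- The model on `latentTree q` in which the correlation along each edge is `r` times the
identity. -/
noncomputable def model {l : ℕ} {ρmax : ℝ} (hl : 1 ≤ l) (ho : 3 ≤ o)
    (q : Fin o → Fin o ⊕ Fin 1)
    (hh : ∀ i, i ≠ Sum.inr 0 → depth q (parent q i) < depth q i)
    (hq3 : ∀ i : Fin o, (i : ℕ) < 3 → q i = Sum.inr 0) {r : ℝ} (h0 : 0 < r) (h1 : r < 1)
    {D : ℕ} (hD : 1 ≤ D) (hρ : D * (l * -Real.log r) ≤ ρmax)
    (hpow : ∀ i j, i ≠ j → ∃ k, 1 ≤ k ∧ k ≤ D ∧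
      RootedTree.cov (parent q) (Sum.inr 0) r i j = r ^ k) : LatentTreeModel o l ρmax where
  tree := latentTree q hh
  cov := vectorCov l q r
  hidden_degree := by
    intro j
    have hsub : Set.range (fun k : Fin 3 => (Sum.inl (Fin.castLE ho k) : Fin o ⊕ Fin 1)) ⊆
        (RootedTree.graph (parent q) (Sum.inr 0)).neighborSet (Sum.inr j) := by
      rintro _ ⟨k, rfl⟩
      rw [SimpleGraph.mem_neighborSet, RootedTree.graph_adj]
      refine ⟨by simp, Or.inr ⟨by simp, ?_⟩⟩
      rw [Subsingleton.elim (α := Fin 1) j 0]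
      exact hq3 _ k.2
    have hinj : Function.Injective
        (fun k : Fin 3 => (Sum.inl (Fin.castLE ho k) : Fin o ⊕ Fin 1)) :=
      Sum.inl_injective.comp (Fin.castLE_injective ho)
    have hcard := Set.ncard_le_ncard hsub (Set.toFinite _)
    rwa [← Set.image_univ, Set.ncard_image_of_injective _ hinj, Set.ncard_univ,
      Nat.card_eq_fintype_card, Fintype.card_fin] at hcard
  posDef := (RootedTree.posDef_cov hh h0 h1).kronecker Matrix.PosDef.one
  adj_iff _ _ hij := graph_adj_iff_nodeBlock_ne_zero hl hh h0 h1 hij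
  distance_bounds := by
    have hlog : 0 < l * -Real.log r :=
      mul_pos (by exact_mod_cast hl) (neg_pos.2 (Real.log_neg h0 h1))
    refine ⟨l * -Real.log r, hlog, ?_, ?_⟩
    · refine le_trans ?_ hρ
      exact le_mul_of_one_le_left hlog.le (by exact_mod_cast hD)
    · intro i j hij
      obtain ⟨k, hk1, hk2, e⟩ := hpow i j hij
      have := informationDistance_kronecker_one (l := l) (RootedTree.cov_self hh r) h0 e
      refine this ▸ ⟨le_mul_of_one_le_left hlog.le (by exact_mod_cast hk1), ?_⟩
      exact (mul_le_mul_of_nonneg_right (by exact_mod_cast hk2) hlog.le).trans hρ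

/-- An isomorphism that fixes the observed nodes fixes the one hidden node too. The parent of a
leaf can then be read off, as its only neighbour. -/
lemma eq_of_same (hC : ∀ c ∈ C, c = Sum.inr 0 ∨ ∃ j : Fin o, (j : ℕ) < m ∧ c = Sum.inl j)
    {q' : Fin o → Fin o ⊕ Fin 1} (hq : q ∈ attachments o m C) (hq' : q' ∈ attachments o m C)
    (hh : ∀ i, i ≠ Sum.inr 0 → depth q (parent q i) < depth q i)
    (hh' : ∀ i, i ≠ Sum.inr 0 → depth q' (parent q' i) < depth q' i)
    (hs : (latentTree q hh).Same (latentTree q' hh')) : q = q' := by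
  obtain ⟨f, hf⟩ := hs
  have hfix : ∀ x : Fin o ⊕ Fin 1, f x = x := by
    rintro (i | i)
    · exact hf i
    · rcases hfi : f (Sum.inr i) with j | j
      · rw [← hf j] at hfi
        exact absurd (f.injective hfi) (by simp)
      · exact hfi.trans (congrArg Sum.inr (Subsingleton.elim (α := Fin 1) j i))
  funext i
  by_cases hi : (i : ℕ) < m
  · rw [eq_root_of_mem_attachments hq hi, eq_root_of_mem_attachments hq' hi]
  · have hadj : (RootedTree.graph (parent q) (Sum.inr 0)).Adj (Sum.inl i) (q i) :=
      RootedTree.graph_adj_parent hh (i := Sum.inl i) (by simp)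
    have hadj' : (RootedTree.graph (parent q') (Sum.inr 0)).Adj (Sum.inl i) (q i) := by
      have := f.map_adj_iff.2 hadj
      rwa [hfix, hfix] at this
    rcases (RootedTree.graph_adj.1 hadj').2 with ⟨-, e⟩ | ⟨hne, e⟩
    · exact e.symm
    · obtain ⟨j, hj, ej⟩ := (hC _ (mem_of_mem_attachments hq hi)).resolve_left hne
      rw [ej] at e
      have := (eq_root_of_mem_attachments hq' hj).symm.trans e
      simp at this

/-- The converse for the trees in `attachments o m C`: the decoder errs if the relative entropy of
`n` samples is below the logarithm of the number of trees. -/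
theorem exists_le_errorProb {l n D : ℕ} {ρmax δ r : ℝ} (hl : 1 ≤ l) (hm3 : 3 ≤ m) (hmo : m ≤ o)
    (hC : ∀ c ∈ C, c = Sum.inr 0 ∨ ∃ j : Fin o, (j : ℕ) < m ∧ c = Sum.inl j)
    (hCne : C.Nonempty) (hD : 3 ≤ D)
    (hD' : 4 ≤ D ∨ ∀ c ∈ C, ∀ c' ∈ C, c ≠ Sum.inr 0 → c' ≠ Sum.inr 0 → c = c')
    (h0 : 0 < r) (h1 : r < 1) (hρ : D * (l * -Real.log r) ≤ ρmax)
    (hn : n * (l * o / 2 * -Real.log (1 - r ^ 2)) + Real.log 2 ≤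
      (1 - δ) * ((o - m : ℕ) * Real.log C.card))
    {φ : (Fin n → Fin o × Fin l → ℝ) → LatentTree o} (hφ : Measurable φ) :
    ∃ θ : LatentTreeModel o l ρmax, δ ≤ θ.errorProb φ := by
  have hh : ∀ q : attachments o m C, ∀ i, i ≠ Sum.inr 0 →
      depth q.1 (parent q.1 i) < depth q.1 i := fun q => depth_parent_lt hC q.2
  let θ : attachments o m C → LatentTreeModel o l ρmax := fun q =>
    model hl (hm3.trans hmo) q.1 (hh q)
      (fun i hi => eq_root_of_mem_attachments q.2 (hi.trans_le hm3)) h0 h1 (by omega) hρ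
      fun i j hij => exists_cov_eq_pow hC q.2 hD hD' r hij
  let S := fun q : attachments o m C => vectorCov l q.1 r
  have hS : ∀ q, (S q).PosDef := fun q => (θ q).posDef
  have hdiag : ∀ q i, S q i i = 1 := fun q i => by
    simp [S, RootedTree.cov_self (hh q)]
  have hdet : ∀ q, -(Real.log (S q).det / 2) = l * o / 2 * -Real.log (1 - r ^ 2) := fun q => by
    simp only [S, Matrix.det_kronecker, RootedTree.det_cov (hh q), Matrix.det_one, one_pow,
      mul_one, Real.log_pow, Fintype.card_sum, Fintype.card_fin, Nat.add_sub_cancel]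
    ring
  have hne : Nonempty (attachments o m C) := by
    rw [Finset.nonempty_coe_sort, ← Finset.card_pos, card_attachments hmo]
    exact pow_pos hCne.card_pos _
  have hcard : Real.log (Fintype.card (attachments o m C)) =
      (o - m : ℕ) * Real.log C.card := by
    rw [Fintype.card_coe, card_attachments hmo, Nat.cast_pow, Real.log_pow]
  let A : attachments o m C →
      Set (Fin n → EuclideanSpace ℝ ((Fin o ⊕ Fin 1) × Fin l)) := fun q =>
    {X | (φ fun k i => X k (Sum.inl i.1, i.2)).Same (θ q).tree}
  obtain ⟨q, hq⟩ := exists_measureReal_pi_le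
    (P := fun q => multivariateGaussian 0 (S q))
    (Q := stdGaussian (EuclideanSpace ℝ ((Fin o ⊕ Fin 1) × Fin l)))
    (w := fun q => whiteningDensity (S q)) (fun q => measurable_whiteningDensity (S q))
    (fun q => whiteningDensity_pos (hS q))
    (fun q => stdGaussian_eq_withDensity_whiteningDensity (hS q))
    (fun q => integrable_log_whiteningDensity (hS q))
    (D := l * o / 2 * -Real.log (1 - r ^ 2))
    (fun q => by rw [integral_log_whiteningDensity (hS q) (hdiag q), hdet]) (n := n) (A := A)
    (fun q => by
      have : Measurable fun X : Fin n → EuclideanSpace ℝ ((Fin o ⊕ Fin 1) × Fin l) =>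
          φ fun k i => X k (Sum.inl i.1, i.2) := hφ.comp (by fun_prop)
      exact this (show MeasurableSet {T : LatentTree o | T.Same (θ q).tree} from trivial))
    (fun q q' hqq => Set.disjoint_left.2 fun X hX hX' => hqq <| Subtype.ext <|
      eq_of_same hC q.2 q'.2 (hh q) (hh q') (hX.symm.trans hX')) (t := 1 - δ)
    (by rw [hcard]; exact hn)
  refine ⟨θ q, ?_⟩
  rw [(θ q).errorProb_eq hφ]
  have : (Measure.pi fun _ : Fin n => multivariateGaussian 0 (θ q).cov).real
      {X | (φ fun k i => X k (Sum.inl i.1, i.2)).Same (θ q).tree} ≤ 1 - δ := hq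
  linarith

end HiddenRoot

/-! ### Sample sizes -/

open HiddenRoot

/-- About `√o` children of the root leave at least two thirds of the observed nodes free to choose
one of them as parent. -/
lemma exists_numHubs {o : ℕ} (ho : 27 ≤ o) :
    ∃ m : ℕ, 3 ≤ m ∧ m ≤ o ∧ o * Real.log o / 3 ≤ (o - m : ℕ) * Real.log m := by
  set s := Nat.sqrt o with hs
  have h1 : s * s ≤ o := Nat.sqrt_le o
  have h2 : o < (s + 1) * (s + 1) := Nat.lt_succ_sqrt o
  have hs5 : 5 ≤ s := Nat.le_sqrt.2 (by omega)
  have h3 : 3 * (s + 1) ≤ o := by nlinarith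
  refine ⟨s + 1, by omega, by omega, ?_⟩
  have hcast : ((o - (s + 1) : ℕ) : ℝ) = o - (s + 1 : ℕ) := Nat.cast_sub (by omega)
  have h3' : 3 * ((s + 1 : ℕ) : ℝ) ≤ o := by exact_mod_cast h3
  have h2' : (o : ℝ) ≤ ((s + 1 : ℕ) : ℝ) ^ 2 := by
    rw [pow_two]; exact_mod_cast h2.le
  have ho0 : (0 : ℝ) < o := by exact_mod_cast (by omega : 0 < o)
  have hlog : Real.log o ≤ 2 * Real.log (s + 1 : ℕ) := by
    have := Real.log_le_log ho0 h2'
    rwa [Real.log_pow, Nat.cast_ofNat] at this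
  have hlog0 : 0 ≤ Real.log (s + 1 : ℕ) := Real.log_natCast_nonneg _
  rw [hcast]
  nlinarith

/-- The decoder errs on trees of depth two in which many observed nodes choose among many parents.
Their diameter is at most four edges, of length `ρmax / 4`. -/
theorem exists_le_errorProb_of_depth_two {o l n : ℕ} {ρmax δ : ℝ} (ho : 27 ≤ o) (hl : 1 ≤ l)
    (hρ : 0 < ρmax) (hδ : δ ≤ 1)
    (hn : n * (l * o / 2 * -Real.log (1 - Real.exp (-(ρmax / (2 * l))))) + Real.log 2 ≤
      (1 - δ) * (o * Real.log o / 3))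
    {φ : (Fin n → Fin o × Fin l → ℝ) → LatentTree o} (hφ : Measurable φ) :
    ∃ θ : LatentTreeModel o l ρmax, δ ≤ θ.errorProb φ := by
  obtain ⟨m, hm3, hmo, hm⟩ := exists_numHubs ho
  have hl0 : (0 : ℝ) < l := by exact_mod_cast hl
  let hub : Fin m ↪ Fin o ⊕ Fin 1 :=
    ⟨fun j => Sum.inl (Fin.castLE hmo j), Sum.inl_injective.comp (Fin.castLE_injective hmo)⟩
  have hr : Real.exp (-(ρmax / (4 * l))) ^ 2 = Real.exp (-(ρmax / (2 * l))) := by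
    rw [← Real.exp_nat_mul]
    congr 1
    field_simp
    norm_num
  refine exists_le_errorProb (r := Real.exp (-(ρmax / (4 * l)))) (C := Finset.univ.map hub)
    (D := 4) hl hm3 hmo ?_ ?_ (by norm_num) (Or.inl le_rfl) (Real.exp_pos _) ?_ ?_ ?_ hφ
  · intro c hc
    obtain ⟨j, -, rfl⟩ := Finset.mem_map.1 hc
    exact Or.inr ⟨Fin.castLE hmo j, j.2, rfl⟩
  · exact ⟨hub ⟨0, by omega⟩, Finset.mem_map_of_mem _ (Finset.mem_univ _)⟩
  · exact Real.exp_lt_one_iff.2 (neg_neg_of_pos (by positivity))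
  · rw [Real.log_exp]
    apply le_of_eq
    push_cast
    field_simp
  · rw [hr, Finset.card_map, Finset.card_univ, Fintype.card_fin]
    exact hn.trans (mul_le_mul_of_nonneg_left hm (by linarith))

/-- The decoder errs on trees in which all but three observed nodes choose between two adjacent
nodes as parent. Their diameter is at most three edges, of length `ρmax / 3`. -/
theorem exists_le_errorProb_of_double_star {o l n : ℕ} {ρmax δ : ℝ} (ho : 3 ≤ o) (hl : 1 ≤ l)
    (hρ : 0 < ρmax)
    (hn : n * (l * o / 2 * -Real.log (1 - Real.exp (-(2 * ρmax / (3 * l))))) + Real.log 2 ≤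
      (1 - δ) * ((o - 3) * Real.log 2))
    {φ : (Fin n → Fin o × Fin l → ℝ) → LatentTree o} (hφ : Measurable φ) :
    ∃ θ : LatentTreeModel o l ρmax, δ ≤ θ.errorProb φ := by
  have hl0 : (0 : ℝ) < l := by exact_mod_cast hl
  have hr : Real.exp (-(ρmax / (3 * l))) ^ 2 = Real.exp (-(2 * ρmax / (3 * l))) := by
    rw [← Real.exp_nat_mul]
    congr 1
    push_cast
    ring
  refine exists_le_errorProb (r := Real.exp (-(ρmax / (3 * l)))) (m := 3)
    (C := {Sum.inr 0, Sum.inl ⟨0, by omega⟩})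
    (D := 3) hl le_rfl ho ?_ (Finset.insert_nonempty _ _) le_rfl (Or.inr ?_) (Real.exp_pos _)
    ?_ ?_ ?_ hφ
  · intro c hc
    rcases Finset.mem_insert.1 hc with rfl | hc
    · exact Or.inl rfl
    · exact Or.inr ⟨_, Nat.zero_lt_succ 2, Finset.mem_singleton.1 hc⟩
  · intro c hc c' hc' hne hne'
    rw [Finset.mem_singleton.1 (Finset.mem_of_mem_insert_of_ne hc hne),
      Finset.mem_singleton.1 (Finset.mem_of_mem_insert_of_ne hc' hne')]
  · exact Real.exp_lt_one_iff.2 (neg_neg_of_pos (by positivity))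
  · rw [Real.log_exp]
    apply le_of_eq
    push_cast
    field_simp
  · rw [hr, Finset.card_pair (by simp), Nat.cast_sub ho]
    exact_mod_cast hn

lemma neg_log_one_sub_exp_neg_pos {x : ℝ} (hx : 0 < x) : 0 < -Real.log (1 - Real.exp (-x)) := by
  have h1 := Real.exp_pos (-x)
  have h2 : Real.exp (-x) < 1 := Real.exp_lt_one_iff.2 (by linarith)
  exact neg_pos.2 (Real.log_neg (by linarith) (by linarith))

lemma neg_log_one_sub_exp_neg_le {x : ℝ} (hx : 1 ≤ x) :
    -Real.log (1 - Real.exp (-x)) ≤ 2 * Real.exp (-x) := by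
  have h0 := Real.exp_pos (-x)
  have h1 : Real.exp (-x) ≤ 1 / 2 := by
    have h2 := Real.add_one_le_exp x
    rw [Real.exp_neg, one_div]
    exact inv_anti₀ two_pos (by linarith)
  have h3 := Real.one_sub_inv_le_log_of_pos (x := 1 - Real.exp (-x)) (by linarith)
  have h4 : (1 - Real.exp (-x))⁻¹ ≤ 1 + 2 * Real.exp (-x) := by
    rw [inv_le_comm₀ (by linarith) (by linarith), inv_le_iff_one_le_mul₀ (by linarith)]
    nlinarith
  linarith

lemma floor_logb_mul_log_three_le {o : ℕ} (ho : 3 ≤ o) :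
    (⌊Real.logb 3 o⌋₊ : ℝ) * Real.log 3 ≤ Real.log o := by
  have ho1 : (1 : ℝ) ≤ o := by exact_mod_cast (by omega : 1 ≤ o)
  have h := Nat.floor_le (Real.logb_nonneg (b := 3) (by norm_num) ho1)
  rw [Real.logb, le_div_iff₀ (Real.log_pos (by norm_num))] at h
  exact h

lemma log_three_bounds : 1 < Real.log 3 ∧ Real.log 3 < 6 / 5 := by
  constructor
  · rw [Real.lt_log_iff_exp_lt (by norm_num)]
    exact Real.exp_one_lt_d9.trans (by norm_num)
  · have h : Real.log ((3 : ℝ) ^ 5) < Real.log ((2 : ℝ) ^ 8) :=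
      Real.log_lt_log (by norm_num) (by norm_num)
    rw [Real.log_pow, Real.log_pow] at h
    have := Real.log_two_lt_d9
    push_cast at h
    linarith

/-- The sample sizes of the non-asymptotic converse. -/
theorem exists_le_errorProb_of_lt_max {o l n : ℕ} {ρmax δ : ℝ} (ho : 3 ≤ o) (hl : 1 ≤ l)
    (hρ : 0 < ρmax) (hδ0 : 0 < δ) (hδ1 : δ < 1)
    (hn : (n : ℝ) < max
        ((2 * (1 - δ) * (Real.log ((3 : ℝ) ^ (1 / 3 : ℝ)) * (⌊Real.logb 3 o⌋₊ : ℝ) - 1) - 2 / (o : ℝ)) /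
          (-(l : ℝ) * Real.log (1 - Real.exp (-(ρmax / ((⌊Real.logb 3 o⌋₊ : ℝ) * (l : ℝ)))))))
        (((1 - δ) / 5 - 2 / (o : ℝ)) /
          (-(l : ℝ) * Real.log (1 - Real.exp (-(2 * ρmax / (3 * (l : ℝ))))))))
    {φ : (Fin n → Fin o × Fin l → ℝ) → LatentTree o} (hφ : Measurable φ) :
    ∃ θ : LatentTreeModel o l ρmax, δ ≤ θ.errorProb φ := by
  have hl0 : (0 : ℝ) < l := by exact_mod_cast hl
  have ho0 : (0 : ℝ) < o := by exact_mod_cast (by omega : 0 < o)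
  have hn0 : (0 : ℝ) ≤ n := Nat.cast_nonneg n
  have hlog2 := Real.log_two_lt_d9
  have hlog2' := Real.log_two_gt_d9
  have ho2 : (o : ℝ) * (2 / o) = 2 := by field_simp
  rcases lt_max_iff.1 hn with hn | hn
  · set L := ⌊Real.logb 3 o⌋₊ with hL
    have h3 : Real.log ((3 : ℝ) ^ (1 / 3 : ℝ)) = Real.log 3 / 3 := by
      rw [Real.log_rpow (by norm_num)]
      ring
    rw [h3] at hn
    have hLlog := floor_logb_mul_log_three_le ho
    rw [← hL] at hLlog
    have hb := log_three_bounds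
    -- for `L ≤ 2` the numerator of the bound is negative
    have hL3 : 3 ≤ L := by
      by_contra! hL2
      have hL2' : (L : ℝ) ≤ 2 := by exact_mod_cast (by omega : L ≤ 2)
      have hnum : 2 * (1 - δ) * (Real.log 3 / 3 * L - 1) - 2 / (o : ℝ) ≤ 0 := by
        have : Real.log 3 / 3 * L - 1 ≤ 0 := by nlinarith
        have h2 : 0 ≤ 2 / (o : ℝ) := by positivity
        nlinarith [mul_nonneg (sub_nonneg.2 hδ1.le) (neg_nonneg.2 this)]
      have hden : 0 ≤ -(l : ℝ) * Real.log (1 - Real.exp (-(ρmax / ((L : ℝ) * l)))) := by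
        have : Real.log (1 - Real.exp (-(ρmax / ((L : ℝ) * l)))) ≤ 0 := by
          have h0 : 0 ≤ ρmax / ((L : ℝ) * l) := by positivity
          have h1 : Real.exp (-(ρmax / ((L : ℝ) * l))) ≤ 1 := Real.exp_le_one_iff.2 (by linarith)
          exact Real.log_nonpos (by linarith) (by linarith [Real.exp_pos (-(ρmax / ((L : ℝ) * l)))])
        nlinarith
      exact absurd hn (not_lt.2 ((div_nonpos_of_nonpos_of_nonneg hnum hden).trans hn0))
    have hL3' : (3 : ℝ) ≤ L := by exact_mod_cast hL3
    have ho27 : 27 ≤ o := by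
      have : Real.log 27 ≤ Real.log o := by
        have h27 : Real.log 27 = 3 * Real.log 3 := by
          rw [show (27 : ℝ) = 3 ^ 3 by norm_num, Real.log_pow]
          norm_num
        rw [h27]
        nlinarith
      exact_mod_cast (Real.log_le_log_iff (by norm_num) ho0).1 this
    set w := -Real.log (1 - Real.exp (-(ρmax / ((L : ℝ) * l)))) with hw
    have hwpos : 0 < w := neg_log_one_sub_exp_neg_pos (by positivity)
    have hw2 : -Real.log (1 - Real.exp (-(ρmax / (2 * l)))) ≤ w := by
      have hx : ρmax / ((L : ℝ) * l) ≤ ρmax / (2 * l) := by gcongr; linarith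
      have hx0 : 0 < ρmax / ((L : ℝ) * l) := by positivity
      have h1 : Real.exp (-(ρmax / ((L : ℝ) * l))) < 1 := Real.exp_lt_one_iff.2 (by linarith)
      have h2 : Real.exp (-(ρmax / (2 * l))) ≤ Real.exp (-(ρmax / ((L : ℝ) * l))) :=
        Real.exp_le_exp.2 (by linarith)
      exact neg_le_neg (Real.log_le_log (by linarith) (by linarith))
    refine exists_le_errorProb_of_depth_two ho27 hl hρ hδ1.le ?_ hφ
    rw [show -(l : ℝ) * Real.log (1 - Real.exp (-(ρmax / ((L : ℝ) * l)))) = l * w by rw [hw]; ring,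
      lt_div_iff₀ (by positivity)] at hn
    have h1 : (n : ℝ) * (l * o / 2 * -Real.log (1 - Real.exp (-(ρmax / (2 * l))))) ≤
        o / 2 * (n * (l * w)) := by
      calc _ ≤ (n : ℝ) * (l * o / 2 * w) := by gcongr
        _ = _ := by ring
    have h2 : (o : ℝ) / 2 * (n * (l * w)) ≤
        o / 2 * (2 * (1 - δ) * (Real.log 3 / 3 * L - 1) - 2 / o) := by gcongr
    have h3 : (1 - δ) * (o * (L * Real.log 3)) ≤ (1 - δ) * (o * Real.log o) := by
      have : 0 ≤ 1 - δ := by linarith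
      gcongr
    have h4 : 0 ≤ (1 - δ) * o := mul_nonneg (by linarith) ho0.le
    linarith
  · set w := -Real.log (1 - Real.exp (-(2 * ρmax / (3 * l)))) with hw
    have hwpos : 0 < w := neg_log_one_sub_exp_neg_pos (by positivity)
    rw [show -(l : ℝ) * Real.log (1 - Real.exp (-(2 * ρmax / (3 * l)))) = l * w by rw [hw]; ring,
      lt_div_iff₀ (by positivity)] at hn
    refine exists_le_errorProb_of_double_star ho hl hρ ?_ hφ
    have h2 : (o : ℝ) / 2 * (n * (l * w)) ≤ o / 2 * ((1 - δ) / 5 - 2 / o) := by gcongr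
    -- a sample size below the bound exists only for more than ten observed nodes
    have ho10 : (10 : ℝ) ≤ o := by
      have h3 : 0 < (o : ℝ) * ((1 - δ) / 5 - 2 / o) :=
        mul_pos ho0 (lt_of_le_of_lt (by positivity) hn)
      nlinarith
    have h4 : (1 - δ) * (o / 10) ≤ (1 - δ) * ((o - 3) * Real.log 2) := by
      refine mul_le_mul_of_nonneg_left ?_ (by linarith)
      nlinarith
    rw [← hw]
    linarith

/-- The sample sizes of the asymptotic converse. The non-asymptotic bound does not imply it, since
`ρmax / (⌊log₃ o⌋ l)` need not be bounded away from zero. But trees of depth two do: they require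
`exp (ρmax / (2 l)) log o` samples, up to a constant, which is more. -/
theorem le_of_forall_errorProb_lt {o l n : ℕ} {ρmax δ : ℝ} (hl : 1 ≤ l)
    (hδ0 : 0 < δ) (hδ1 : δ < 1) (ho27 : 27 ≤ o) (ho : 27 ≤ (1 - δ) * o) (hρ : 2 * (l : ℝ) ≤ ρmax)
    {φ : (Fin n → Fin o × Fin l → ℝ) → LatentTree o} (hφ : Measurable φ)
    (herr : ∀ θ : LatentTreeModel o l ρmax, θ.errorProb φ < δ) :
    max (1 / 6 / (l : ℝ) * ((1 - δ) *
        Real.exp (ρmax / ((⌊Real.logb 3 o⌋₊ : ℝ) * (l : ℝ))) * Real.log o))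
      (1 / 6 / (l : ℝ) * ((1 - δ) * Real.exp (2 * ρmax / (3 * (l : ℝ))))) ≤ (n : ℝ) := by
  have hl0 : (0 : ℝ) < l := by exact_mod_cast hl
  have ho0 : (0 : ℝ) < o := by exact_mod_cast (by omega : 0 < o)
  have hρ0 : 0 < ρmax := by linarith
  have hδ : 0 < 1 - δ := by linarith
  have hlog2 := Real.log_two_lt_d9
  have hlog2' := Real.log_two_gt_d9
  have hnot : ¬ ∃ θ : LatentTreeModel o l ρmax, δ ≤ θ.errorProb φ := by
    rintro ⟨θ, hθ⟩
    exact (herr θ).not_ge hθ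
  -- the common last step: a lower bound on `n * w` with `w ≤ 2 * exp (-x)`
  have hfinal : ∀ x K : ℝ, 1 ≤ x → (1 - δ) * (o * K) / 6 ≤
      n * (l * o / 2 * -Real.log (1 - Real.exp (-x))) →
      1 / 6 / (l : ℝ) * ((1 - δ) * Real.exp x * K) ≤ n := by
    intro x K hx hK
    have h1 : (n : ℝ) * (l * o / 2 * -Real.log (1 - Real.exp (-x))) ≤
        n * (l * o / 2 * (2 * Real.exp (-x))) := by
      have := neg_log_one_sub_exp_neg_le hx
      gcongr
    have h2 : o * ((1 - δ) * K / 6) ≤ o * (n * l * Real.exp (-x)) := by linarith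
    have h3 := le_of_mul_le_mul_left h2 ho0
    rw [Real.exp_neg, ← div_eq_mul_inv, le_div_iff₀ (Real.exp_pos x)] at h3
    have h4 : 1 / 6 / (l : ℝ) * ((1 - δ) * Real.exp x * K) =
        ((1 - δ) * K / 6 * Real.exp x) / l := by ring
    rw [h4, div_le_iff₀ hl0]
    exact h3
  refine max_le ?_ ?_
  · have hlogo : 1 ≤ Real.log o := by
      have h1 := log_three_bounds.1
      have h2 : Real.log 3 ≤ Real.log o :=
        Real.log_le_log (by norm_num) (by exact_mod_cast (by omega : 3 ≤ o))
      linarith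
    have hx : 1 ≤ ρmax / (2 * l) := by
      rw [le_div_iff₀ (by positivity)]
      linarith
    have hmain := hfinal (ρmax / (2 * l)) (Real.log o) hx (by
      by_contra! hlt
      refine hnot (exists_le_errorProb_of_depth_two ho27 hl hρ0 hδ1.le ?_ hφ)
      have : 27 * 1 ≤ (1 - δ) * o * Real.log o := by gcongr
      linarith)
    refine le_trans ?_ hmain
    have hL : (2 : ℝ) ≤ (⌊Real.logb 3 o⌋₊ : ℝ) := by
      have : 2 ≤ ⌊Real.logb 3 o⌋₊ := by
        refine Nat.le_floor ?_
        rw [Nat.cast_ofNat, Real.le_logb_iff_rpow_le (by norm_num) ho0]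
        norm_num
        exact_mod_cast (by omega : 9 ≤ o)
      exact_mod_cast this
    gcongr
  · have hx : 1 ≤ 2 * ρmax / (3 * l) := by
      rw [le_div_iff₀ (by positivity)]
      linarith
    have hmain := hfinal (2 * ρmax / (3 * l)) 1 hx (by
      by_contra! hlt
      refine hnot (exists_le_errorProb_of_double_star (by omega) hl hρ0 ?_ hφ)
      have h1 : (1 - δ) * (o / 2 - 3) ≤ (1 - δ) * ((o - 3) * Real.log 2 - o / 6) := by
        refine mul_le_mul_of_nonneg_left ?_ hδ.le
        nlinarith
      linarith)
    rwa [mul_one] at hmain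
theorem mainTheorem3 :
    -- the non-asymptotic form
    (∀ (o l n : ℕ) (ρmax δ : ℝ), 3 ≤ o → 1 ≤ l → 0 < ρmax → 0 < δ → δ < 1 →
      (n : ℝ) < max
        ((2 * (1 - δ) * (Real.log ((3 : ℝ) ^ (1 / 3 : ℝ)) * (⌊Real.logb 3 o⌋₊ : ℝ) - 1) - 2 / (o : ℝ)) /
          (-(l : ℝ) * Real.log (1 - Real.exp (-(ρmax / ((⌊Real.logb 3 o⌋₊ : ℝ) * (l : ℝ)))))))
        (((1 - δ) / 5 - 2 / (o : ℝ)) /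
          (-(l : ℝ) * Real.log (1 - Real.exp (-(2 * ρmax / (3 * (l : ℝ))))))) →
      ∀ φ : (Fin n → Fin o × Fin l → ℝ) → LatentTree o, Measurable φ →
        ∃ θ : LatentTreeModel o l ρmax, δ ≤ θ.errorProb φ) ∧
    -- the asymptotic form, as `ρmax` and the number `o` of observed nodes tend to infinity
    (∃ c : ℝ, 0 < c ∧ ∀ l : ℕ, 1 ≤ l → ∀ δ : ℝ, 0 < δ → δ < 1 →
      ∃ (o₀ : ℕ) (ρ₀ : ℝ), ∀ (o : ℕ) (ρmax : ℝ), 3 ≤ o → 0 < ρmax → o₀ ≤ o → ρ₀ ≤ ρmax →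
        ∀ (n : ℕ) (φ : (Fin n → Fin o × Fin l → ℝ) → LatentTree o), Measurable φ →
          (∀ θ : LatentTreeModel o l ρmax, θ.errorProb φ < δ) →
          max
            (c / (l : ℝ) * ((1 - δ) *
              Real.exp (ρmax / ((⌊Real.logb 3 o⌋₊ : ℝ) * (l : ℝ))) * Real.log o))
            (c / (l : ℝ) * ((1 - δ) * Real.exp (2 * ρmax / (3 * (l : ℝ))))) ≤ (n : ℝ)) := by
  refine ⟨fun o l n ρmax δ ho hl hρ hδ0 hδ1 hn φ hφ =>
    exists_le_errorProb_of_lt_max ho hl hρ hδ0 hδ1 hn hφ, 1 / 6, by norm_num, ?_⟩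
  intro l hl δ hδ0 hδ1
  refine ⟨max 27 ⌈27 / (1 - δ)⌉₊, 2 * l, fun o ρmax _ _ ho hρ n φ hφ herr => ?_⟩
  have h1 : 27 / (1 - δ) ≤ o := Nat.ceil_le.1 ((le_max_right _ _).trans ho)
  rw [div_le_iff₀' (by linarith)] at h1
  exact le_of_forall_errorProb_lt hl hδ0 hδ1 ((le_max_left _ _).trans ho) h1 hρ hφ herr
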